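/- Write $|D^n_w\rangle$ for the $n$-qubit Dicke state, i.e. the normalized uniform superposition of the $\binom nw$ computational basis states of Hamming weight $w$. For every integer $r\ge 3$ put $$|\overline 0\rangle=\tfrac{1}{\sqrt{2^{r+1}}}\Big(\sqrt{2^r-3}\,|D^{2^r+3}_{0}\rangle+\sqrt{2^r+3}\,|D^{2^r+3}_{2^r}\rangle\Big),\qquad |\overline 1\rangle=\tfrac{1}{\sqrt{2^{r+1}}}\Big(\sqrt{2^r+3}\,|D^{2^r+3}_{3}\rangle+\sqrt{2^r-3}\,|D^{2^r+3}_{2^r+3}\rangle\Big).$$ Then $|\overline 0\rangle,|\overline 1\rangle$ are orthonormal and their span is a $((2^r+3,2,3))$ code: it is a $2$-dimensional subspace of $(\mathbb C^2)^{\otimes(2^r+3)}$, and its distance, i.e. the largest $d$ such that the Knill--Laflamme conditions $\langle u|E|v\rangle=c_E\langle u|v\rangle$ hold for all codewords $u,v$ and all Pauli errors $E$ of weight less than $d$, is $3$. The code is permutationally invariant (every permutation of the qubits fixes every codeword). It is non-additive: neither it nor any code related to it by local unitaries and qubit permutations is a stabilizer code. Its transversal group, i.e. the group of all logical gates $g\in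 \mathrm{SU}(2)$ (in the basis $|\overline 0\rangle,|\overline 1\rangle$) that are implemented by some $U_1\otimes\cdots\otimes U_{2^r+3}$ with $U_i\in \mathrm U(2)$, is exactly the generalized quaternion group $$\mathsf Q^{(r)}=\big\langle \mathsf X,\ \mathsf Z,\ \mathsf{Ph}(2\pi/2^r)\big\rangle\subset \mathrm{SU}(2),\qquad \mathsf X=-iX,\quad \mathsf Z=-iZ,\quad \mathsf{Ph}(\alpha)=\mathrm{diag}(e^{-i\alpha/2},e^{i\alpha/2}).$$ An example is the case $r=3$: the orthonormal vectors $|\overline 0\rangle=\tfrac{\sqrt5}{4}|D^{11}_0\rangle+\tfrac{\sqrt{11}}{4}|D^{11}_8\rangle$ and $|\overline 1\rangle=\tfrac{\sqrt{11}}{4}|D^{11}_3\rangle+\tfrac{\sqrt5}{4}|D^{11}_{11}\rangle$ span a non-additive permutationally invariant $((11,2,3))$ code whose transversal group contains $\mathsf T=\mathrm{diag}(e^{-i\pi/8},e^{i\pi/8})$. -/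

import Mathlib

noncomputable section

namespace DickeCode

open Matrix

/-- The Hilbert space `(ℂ²)^{⊗ n}` of `n` qubits; a computational basis vector is a bit string
`x : Fin n → Fin 2`. -/
abbrev Qubits (n : ℕ) : Type := EuclideanSpace ℂ (Fin n → Fin 2)

/-- Operators on `n` qubits, as `2^n × 2^n` matrices in the computational basis. -/
abbrev QubitOp (n : ℕ) : Type := Matrix (Fin n → Fin 2) (Fin n → Fin 2) ℂ

/-- The tensor product `A 0 ⊗ ⋯ ⊗ A (n-1)` of single-qubit operators. -/
def tensorOp {n : ℕ} (A : Fin n → Matrix (Fin 2) (Fin 2) ℂ) : QubitOp n :=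
  Matrix.of fun x y => ∏ i, A i (x i) (y i)

/-- The permutation of the tensor factors by `σ`. -/
def permuteQubits {n : ℕ} (σ : Equiv.Perm (Fin n)) : Qubits n ≃ₗᵢ[ℂ] Qubits n :=
  LinearIsometryEquiv.piLpCongrLeft 2 ℂ ℂ (Equiv.arrowCongr σ (Equiv.refl (Fin 2)))

/-! ### Pauli operators, distance, permutation invariance -/

/-- The single-qubit Pauli matrices `I, X, Y, Z`, in this order. -/
def pauli : Fin 4 → Matrix (Fin 2) (Fin 2) ℂ :=
  ![1, !![0, 1; 1, 0], !![0, -Complex.I; Complex.I, 0], !![1, 0; 0, -1]]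

/-- The `n`-qubit Pauli operator with tensor factors `pauli (s i)`. -/
def pauliString {n : ℕ} (s : Fin n → Fin 4) : QubitOp n :=
  tensorOp fun i => pauli (s i)

/-- The number of tensor factors of a Pauli string that are not the identity. -/
def weight {n : ℕ} (s : Fin n → Fin 4) : ℕ :=
  (Finset.univ.filter fun i => s i ≠ 0).card

/-- The Knill–Laflamme conditions of the code `C` for all Pauli errors of weight less than `d`;
the constant may depend on the error but not on the codewords. -/
def KnillLaflamme {n : ℕ} (C : Submodule ℂ (Qubits n)) (d : ℕ) : Prop :=
  ∀ s : Fin n → Fin 4, weight s < d → ∃ c : ℂ, ∀ u ∈ C, ∀ v ∈ C,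
    inner ℂ u (Matrix.toEuclideanLin (pauliString s) v) = c * inner ℂ u v

/-- `C` is an `((n, K, d))` code: a `K`-dimensional subspace of the `n`-qubit space whose distance,
i.e. the largest `d` for which the Knill–Laflamme conditions hold, is `d`. -/
def IsCode {n : ℕ} (C : Submodule ℂ (Qubits n)) (K d : ℕ) : Prop :=
  Module.finrank ℂ C = K ∧ IsGreatest {e : ℕ | KnillLaflamme C e} d

/-- All codewords are fixed by all permutations of the qubits. -/
def IsPermutationInvariant {n : ℕ} (C : Submodule ℂ (Qubits n)) : Prop :=
  ∀ v ∈ C, ∀ σ : Equiv.Perm (Fin n), permuteQubits σ v = v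

/-! ### Stabilizer codes and non-additive codes -/

/-- Elements of the `n`-qubit Pauli group: a Pauli string times a power of `i`. -/
def IsPauliElement {n : ℕ} (M : QubitOp n) : Prop :=
  ∃ (k : ℕ) (s : Fin n → Fin 4), M = Complex.I ^ k • pauliString s

/-- `C` is a stabilizer code: the joint `+1`-eigenspace of an abelian subgroup of the Pauli group
which does not contain `-1`. -/
def IsStabilizerCode {n : ℕ} (C : Submodule ℂ (Qubits n)) : Prop :=
  ∃ S : Subgroup (Matrix.unitaryGroup (Fin n → Fin 2) ℂ),
    (∀ M ∈ S, IsPauliElement (M : QubitOp n)) ∧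
    (∀ M ∈ S, ∀ N ∈ S, M * N = N * M) ∧
    (∀ M ∈ S, (M : QubitOp n) ≠ -1) ∧
    ∀ v : Qubits n, v ∈ C ↔ ∀ M ∈ S, Matrix.toEuclideanLin (M : QubitOp n) v = v

/-- Two codes are equivalent if they are related by a non-entangling gate, i.e. a product of local
unitary gates and permutations of the qubits. Since permutations normalize the local gates, such a
product is one permutation followed by one local gate. -/
def CodeEquivalent {n : ℕ} (C C' : Submodule ℂ (Qubits n)) : Prop :=
  ∃ (U : Fin n → Matrix.unitaryGroup (Fin 2) ℂ) (σ : Equiv.Perm (Fin n)),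
    C' = C.map (Matrix.toEuclideanLin (tensorOp fun i => (U i : Matrix (Fin 2) (Fin 2) ℂ)) ∘ₗ
      (permuteQubits σ).toLinearEquiv.toLinearMap)

/-- A code is non-additive if neither it nor any code equivalent to it is a stabilizer code. -/
def IsNonAdditive {n : ℕ} (C : Submodule ℂ (Qubits n)) : Prop :=
  ∀ C' : Submodule ℂ (Qubits n), CodeEquivalent C C' → ¬ IsStabilizerCode C'

/-! ### The transversal group -/

theorem tensorOp_mul {n : ℕ} (A B : Fin n → Matrix (Fin 2) (Fin 2) ℂ) :
    tensorOp A * tensorOp B = tensorOp fun i => A i * B i := by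
  ext x y
  simp only [tensorOp, Matrix.mul_apply, Matrix.of_apply, Finset.prod_univ_sum,
    Fintype.piFinset_univ, Finset.prod_mul_distrib]

theorem tensorOp_one {n : ℕ} :
    tensorOp (fun _ : Fin n => (1 : Matrix (Fin 2) (Fin 2) ℂ)) = 1 := by
  ext x y
  by_cases h : x = y
  · subst h; simp [tensorOp]
  · obtain ⟨i, hi⟩ := Function.ne_iff.mp h
    rw [Matrix.one_apply_ne h]
    exact Finset.prod_eq_zero (Finset.mem_univ i) (Matrix.one_apply_ne hi)

/-- The encoding map `|j⟩ ↦ v j`, as a `2^n × 2` matrix. -/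
def encoding {n : ℕ} (v : Fin 2 → Qubits n) : Matrix (Fin n → Fin 2) (Fin 2) ℂ :=
  Matrix.of fun x j => v j x

/-- The transversal group of the code with logical basis `v 0, v 1`: the logical gates
`g ∈ SU(2)` that are implemented by some local unitary gate `U 0 ⊗ ⋯ ⊗ U (n-1)`. (The global phase
of a physical gate is absorbed in the `U i`, so restricting `g` to `SU(2)` only removes phases.) -/
def transversalGroup {n : ℕ} (v : Fin 2 → Qubits n) :
    Subgroup (Matrix.specialUnitaryGroup (Fin 2) ℂ) where
  carrier := {g | ∃ U : Fin n → Matrix.unitaryGroup (Fin 2) ℂ,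
    tensorOp (fun i => (U i : Matrix (Fin 2) (Fin 2) ℂ)) * encoding v =
      encoding v * (g : Matrix (Fin 2) (Fin 2) ℂ)}
  one_mem' := ⟨fun _ => 1, by simp [tensorOp_one]⟩
  mul_mem' := by
    rintro g h ⟨U, hU⟩ ⟨W, hW⟩
    refine ⟨fun i => U i * W i, ?_⟩
    have e : tensorOp (fun i => ((U i * W i : Matrix.unitaryGroup (Fin 2) ℂ) :
        Matrix (Fin 2) (Fin 2) ℂ)) = tensorOp (fun i => (U i : Matrix (Fin 2) (Fin 2) ℂ)) *
        tensorOp (fun i => (W i : Matrix (Fin 2) (Fin 2) ℂ)) := by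
      rw [tensorOp_mul]; rfl
    rw [e, Matrix.mul_assoc, hW, ← Matrix.mul_assoc, hU, Matrix.mul_assoc]
    rfl
  inv_mem' := by
    rintro g ⟨U, hU⟩
    refine ⟨fun i => (U i)⁻¹, ?_⟩
    have e : tensorOp (fun i => (((U i)⁻¹ : Matrix.unitaryGroup (Fin 2) ℂ) :
        Matrix (Fin 2) (Fin 2) ℂ)) * tensorOp (fun i => (U i : Matrix (Fin 2) (Fin 2) ℂ)) = 1 := by
      rw [tensorOp_mul, ← tensorOp_one]
      congr 1
      funext i
      exact Matrix.UnitaryGroup.star_mul_self (U i)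
    have hg : (g : Matrix (Fin 2) (Fin 2) ℂ) *
        ((g⁻¹ : Matrix.specialUnitaryGroup (Fin 2) ℂ) : Matrix (Fin 2) (Fin 2) ℂ) = 1 :=
      congrArg Subtype.val (mul_inv_cancel g)
    calc tensorOp (fun i => (((U i)⁻¹ : Matrix.unitaryGroup (Fin 2) ℂ) :
          Matrix (Fin 2) (Fin 2) ℂ)) * encoding v
        = tensorOp (fun i => (((U i)⁻¹ : Matrix.unitaryGroup (Fin 2) ℂ) :
          Matrix (Fin 2) (Fin 2) ℂ)) * ((encoding v * (g : Matrix (Fin 2) (Fin 2) ℂ)) *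
          ((g⁻¹ : Matrix.specialUnitaryGroup (Fin 2) ℂ) : Matrix (Fin 2) (Fin 2) ℂ)) := by
            rw [Matrix.mul_assoc (encoding v), hg, Matrix.mul_one]
      _ = _ := by
            rw [← hU, ← Matrix.mul_assoc, ← Matrix.mul_assoc, e, Matrix.one_mul]

/-! ### The generalized quaternion groups in `SU(2)` -/

/-- `𝖷 = -i X`. -/
def gateX : Matrix.specialUnitaryGroup (Fin 2) ℂ :=
  ⟨!![0, -Complex.I; -Complex.I, 0], by
    rw [Matrix.mem_specialUnitaryGroup_iff, Matrix.mem_unitaryGroup_iff]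
    refine ⟨?_, ?_⟩
    · ext i j; fin_cases i <;> fin_cases j <;>
        simp [Matrix.mul_apply, Matrix.star_apply, Fin.sum_univ_two]
    · simp [Matrix.det_fin_two]⟩

/-- `𝖹 = -i Z`. -/
def gateZ : Matrix.specialUnitaryGroup (Fin 2) ℂ :=
  ⟨!![-Complex.I, 0; 0, Complex.I], by
    rw [Matrix.mem_specialUnitaryGroup_iff, Matrix.mem_unitaryGroup_iff]
    refine ⟨?_, ?_⟩
    · ext i j; fin_cases i <;> fin_cases j <;>
        simp [Matrix.mul_apply, Matrix.star_apply, Fin.sum_univ_two]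
    · simp [Matrix.det_fin_two]⟩

/-- `𝖯𝗁(α) = diag(e^{-iα/2}, e^{iα/2})`. -/
def gatePh (α : ℝ) : Matrix.specialUnitaryGroup (Fin 2) ℂ :=
  ⟨!![Complex.exp (-Complex.I * α / 2), 0; 0, Complex.exp (Complex.I * α / 2)], by
    have h1 : Complex.exp (-Complex.I * α / 2) * Complex.exp (Complex.I * α / 2) = 1 := by
      rw [← Complex.exp_add, ← Complex.exp_zero]; congr 1; ring
    have h2 : (starRingEnd ℂ) (Complex.exp (-Complex.I * α / 2)) =
        Complex.exp (Complex.I * α / 2) := by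
      rw [← Complex.exp_conj]; congr 1; simp [map_div₀, Complex.conj_ofNat]
    have h3 : (starRingEnd ℂ) (Complex.exp (Complex.I * α / 2)) =
        Complex.exp (-Complex.I * α / 2) := by
      rw [← Complex.exp_conj]; congr 1; simp [map_div₀, Complex.conj_ofNat]
    have h4 := h1
    rw [mul_comm] at h4
    rw [Matrix.mem_specialUnitaryGroup_iff, Matrix.mem_unitaryGroup_iff]
    refine ⟨?_, ?_⟩
    · ext i j
      fin_cases i <;> fin_cases j <;>
        simp only [Matrix.mul_apply, Matrix.star_apply, Fin.sum_univ_two] <;>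
        simp [-neg_mul, h2, h3, h1, h4]
    · simpa [Matrix.det_fin_two] using h1⟩

/-- `𝖳 = diag(e^{-iπ/8}, e^{iπ/8})`, the `SU(2)` form of the gate `diag(1, e^{iπ/4})`. -/
def gateT : Matrix.specialUnitaryGroup (Fin 2) ℂ := gatePh (Real.pi / 4)

/-- The binary dihedral group of (even) degree `m`, generated by `𝖷`, `𝖹` and `𝖯𝗁(2π/m)`. -/
def binaryDihedral (m : ℕ) : Subgroup (Matrix.specialUnitaryGroup (Fin 2) ℂ) :=
  Subgroup.closure {gateX, gateZ, gatePh (2 * Real.pi / m)}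

/-- The generalized quaternion group `Q^(r)`, of order `2^(r+2)`. -/
def generalizedQuaternion (r : ℕ) : Subgroup (Matrix.specialUnitaryGroup (Fin 2) ℂ) :=
  binaryDihedral (2 ^ r)

/-! ### Dicke states and the codewords -/

/-- The Hamming weight of a bit string. -/
def hammingWeight {n : ℕ} (x : Fin n → Fin 2) : ℕ :=
  (Finset.univ.filter fun i => x i = 1).card

/-- The Dicke state `|D^n_w⟩`: the normalized uniform superposition of the `n.choose w` computational
basis states of Hamming weight `w` (for `w ≤ n`). -/
def dicke (n w : ℕ) : Qubits n :=
  WithLp.toLp 2 fun x => if hammingWeight x = w then ((1 / √(n.choose w : ℝ) : ℝ) : ℂ) else 0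

/-- The logical basis states `|0̄⟩` and `|1̄⟩` on `2^r + 3` qubits. -/
def codeword (r : ℕ) : Fin 2 → Qubits (2 ^ r + 3) :=
  ![((1 / √((2 : ℝ) ^ (r + 1)) : ℝ) : ℂ) •
      (((√((2 : ℝ) ^ r - 3) : ℝ) : ℂ) • dicke (2 ^ r + 3) 0 +
        ((√((2 : ℝ) ^ r + 3) : ℝ) : ℂ) • dicke (2 ^ r + 3) (2 ^ r)),
    ((1 / √((2 : ℝ) ^ (r + 1)) : ℝ) : ℂ) •
      (((√((2 : ℝ) ^ r + 3) : ℝ) : ℂ) • dicke (2 ^ r + 3) 3 +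
        ((√((2 : ℝ) ^ r - 3) : ℝ) : ℂ) • dicke (2 ^ r + 3) (2 ^ r + 3))]

/-- The two codewords on `11` qubits:
`|0̄⟩ = (√5/4) |D_0⟩ + (√11/4) |D_8⟩` and `|1̄⟩ = (√11/4) |D_3⟩ + (√5/4) |D_11⟩`. -/
def codeword11 : Fin 2 → Qubits 11 :=
  ![((√5 / 4 : ℝ) : ℂ) • dicke 11 0 + ((√11 / 4 : ℝ) : ℂ) • dicke 11 8,
    ((√11 / 4 : ℝ) : ℂ) • dicke 11 3 + ((√5 / 4 : ℝ) : ℂ) • dicke 11 11]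

/-- The code spanned by two codewords. -/
def codespace {n : ℕ} (v : Fin 2 → Qubits n) : Submodule ℂ (Qubits n) :=
  Submodule.span ℂ (Set.range v)

end DickeCode

end

/-!
The codewords are the case `N = 2 ^ r` of a pair of states on `N + 3` qubits (`dickePair N`) with
real amplitudes that depend only on the Hamming weight, which takes the values `0, N` in the first
state and `3, N + 3` in the second.

Any two of these weights differ by at least three, so an operator on two qubits connects only basis
vectors of equal weight. Its matrix elements are therefore determined by the one- and two-bit
marginals of the squared amplitudes, and by symmetry these follow from the first two moments of the
Hamming weight. The coefficients are such that both states have the same moments; this gives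
`inner_siteOp_mul_siteOp`, by which `A ⊗ B` on any two qubits acts on the code, up to projection, as
the scalar `corr N A B`. Orthonormality and the Knill–Laflamme conditions for weight at most two are
immediate. The error `X ⊗ X ⊗ X` has a positive matrix element between the two codewords, so the
distance is not larger than three.

On traceless Hermitian involutions, with Bloch vectors `a` and `b`, the correlation is
`(3 (a₁ b₁ + a₂ b₂) + (N - 4) a₃ b₃) / (N + 2)`. For `N ≥ 8` this form has norm less than one, is
not zero, and attains its maximum only at `a = b = (0, 0, ± 1)`. Two consequences are drawn from
this.

* If a locally rotated copy of the code were a stabilizer code, consider a Pauli operator `E` of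
  weight two. If it commutes with the stabilizer it preserves the code and its expectation is `± 1`,
  which the norm bound excludes (`siteOp_conj_pauli_not_mem`); so it anticommutes with a stabilizer
  element and has expectation zero (`inner_eq_zero_of_anticommute`). As the rotated Pauli matrices
  span the traceless matrices, the correlation form would vanish, a contradiction.
* A local gate preserving the code preserves the correlation form. As `Z ⊗ Z` is the unique maximum,
  each factor conjugates `Z` to `± Z`, with the same sign for all qubits
  (`diagonal_or_antidiagonal`). Up to the logical gate `𝖷` all factors are diagonal, and comparison
  of the phases of the basis vectors shows that the logical gate is a power of the phase gate up to
  sign (`mem_binaryDihedral_of_diagonal_gates`).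

Conversely, `𝖷`, `𝖹` and the phase gate, each applied to all qubits, implement `𝖷⁻¹`, `𝖹⁻¹` and, up
to sign, the cube of the logical phase gate; the cube generates the phase gate, as `3` is coprime to
its order.
-/

noncomputable section

namespace DickeCode

open Matrix

/-! ### Counting bit strings by Hamming weight -/

theorem hammingWeight_eq_sum {n : ℕ} (x : Fin n → Fin 2) :
    hammingWeight x = ∑ i, (x i : ℕ) := by
  rw [hammingWeight, Finset.card_filter]
  refine Finset.sum_congr rfl fun i _ => ?_
  generalize x i = c
  fin_cases c <;> simp

theorem hammingWeight_update {n : ℕ} (x : Fin n → Fin 2) (i : Fin n) (c : Fin 2) :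
    hammingWeight (Function.update x i c) + (x i : ℕ) = hammingWeight x + (c : ℕ) := by
  rw [hammingWeight_eq_sum, hammingWeight_eq_sum,
    ← Finset.add_sum_erase _ _ (Finset.mem_univ i), ← Finset.add_sum_erase _ (fun j => (x j : ℕ))
      (Finset.mem_univ i), Function.update_self,
    Finset.sum_congr rfl fun j hj => by rw [Function.update_of_ne (Finset.ne_of_mem_erase hj)]]
  omega

theorem hammingWeight_comp_perm {n : ℕ} (x : Fin n → Fin 2) (σ : Equiv.Perm (Fin n)) :
    hammingWeight (x ∘ σ) = hammingWeight x := by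
  rw [hammingWeight_eq_sum, hammingWeight_eq_sum]
  exact Equiv.sum_comp σ fun i => (x i : ℕ)

/-- The bit string whose ones are at the positions in `S`. -/
def bitString {n : ℕ} (S : Finset (Fin n)) : Fin n → Fin 2 := fun i => if i ∈ S then 1 else 0

theorem hammingWeight_bitString {n : ℕ} (S : Finset (Fin n)) :
    hammingWeight (bitString S) = S.card := by
  rw [hammingWeight]
  congr 1
  ext i
  by_cases h : i ∈ S <;> simp [bitString, h]

theorem card_hammingWeight_eq (n w : ℕ) :
    (Finset.univ.filter fun x : Fin n → Fin 2 => hammingWeight x = w).card = n.choose w := by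
  have h : (Finset.powersetCard w (Finset.univ : Finset (Fin n))).card = n.choose w := by simp
  rw [← h]
  refine Finset.card_nbij' (fun x => Finset.univ.filter fun i => x i = 1) bitString ?_ ?_ ?_ ?_
  · intro x hx
    have hx' := (Finset.mem_filter.1 (Finset.mem_coe.1 hx)).2
    simpa [Finset.mem_powersetCard, hammingWeight] using hx'
  · intro S hS
    simpa [Finset.mem_powersetCard, hammingWeight_bitString] using hS
  · intro x _
    funext i
    have : x i = 0 ∨ x i = 1 := by generalize x i = c; fin_cases c <;> simp
    rcases this with h | h <;> simp [bitString, h]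
  · intro S _
    ext i
    by_cases h : i ∈ S <;> simp [bitString, h]

/-- The amplitude of a weight-`u` basis vector in the Dicke state `|D^n_w⟩`. -/
def dickeAmp (n w u : ℕ) : ℝ := if u = w then 1 / √(n.choose w : ℝ) else 0

theorem dicke_apply (n w : ℕ) (x : Fin n → Fin 2) :
    dicke n w x = (dickeAmp n w (hammingWeight x) : ℂ) := by
  simp only [dicke, dickeAmp]
  split_ifs <;> simp

theorem sum_dickeAmp_sq {n w : ℕ} (hw : w ≤ n) (h : ℕ → ℝ) :
    ∑ x : Fin n → Fin 2, dickeAmp n w (hammingWeight x) ^ 2 * h (hammingWeight x) = h w := by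
  have hc : (0 : ℝ) < n.choose w := by exact_mod_cast Nat.choose_pos hw
  have e : ∀ x : Fin n → Fin 2, dickeAmp n w (hammingWeight x) ^ 2 * h (hammingWeight x) =
      if hammingWeight x = w then h w / n.choose w else 0 := by
    intro x
    rw [dickeAmp]
    split_ifs with hx
    · rw [div_pow, Real.sq_sqrt hc.le, hx]; ring
    · ring
  rw [Finset.sum_congr rfl fun x _ => e x, ← Finset.sum_filter, Finset.sum_const,
    card_hammingWeight_eq, nsmul_eq_mul]
  field_simp

theorem sum_comp_perm {n : ℕ} (σ : Equiv.Perm (Fin n)) (f : (Fin n → Fin 2) → ℝ) :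
    ∑ x : Fin n → Fin 2, f (x ∘ σ) = ∑ x, f x :=
  Equiv.sum_comp (Equiv.arrowCongr σ.symm (Equiv.refl (Fin 2))) f

/-- Double counting: a weight-dependent sum restricted to the strings with a one at position `i`
does not depend on `i`. -/
theorem card_mul_sum_bit {n : ℕ} (m : ℕ → ℝ) (i : Fin n) :
    (n : ℝ) * ∑ x : Fin n → Fin 2, m (hammingWeight x) * (x i : ℕ) =
      ∑ x : Fin n → Fin 2, m (hammingWeight x) * hammingWeight x := by
  have sym : ∀ j : Fin n, ∑ x : Fin n → Fin 2, m (hammingWeight x) * (x j : ℕ) =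
      ∑ x : Fin n → Fin 2, m (hammingWeight x) * (x i : ℕ) := by
    intro j
    rw [← sum_comp_perm (Equiv.swap i j)]
    simp [hammingWeight_comp_perm]
  have hs : ∀ x : Fin n → Fin 2, m (hammingWeight x) * hammingWeight x =
      ∑ j, m (hammingWeight x) * (x j : ℕ) := by
    intro x
    rw [← Finset.mul_sum]
    congr 1
    rw [hammingWeight_eq_sum]
    push_cast
    rfl
  rw [Finset.sum_congr rfl fun x _ => hs x, Finset.sum_comm, Finset.sum_congr rfl fun j _ => sym j]
  simp

theorem card_sub_one_mul_sum_bit_bit {n : ℕ} (m : ℕ → ℝ) {i j : Fin n} (hij : i ≠ j) :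
    ((n : ℝ) - 1) * ∑ x : Fin n → Fin 2, m (hammingWeight x) * ((x i : ℕ) * (x j : ℕ)) =
      ∑ x : Fin n → Fin 2, (m (hammingWeight x) * (hammingWeight x - 1)) * (x i : ℕ) := by
  have sym : ∀ k ∈ Finset.univ.erase i,
      ∑ x : Fin n → Fin 2, m (hammingWeight x) * ((x i : ℕ) * (x k : ℕ)) =
      ∑ x : Fin n → Fin 2, m (hammingWeight x) * ((x i : ℕ) * (x j : ℕ)) := by
    intro k hk
    rw [← sum_comp_perm (Equiv.swap j k)]
    simp [hammingWeight_comp_perm,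
      Equiv.swap_apply_of_ne_of_ne hij (Finset.ne_of_mem_erase hk).symm]
  have hs : ∀ x : Fin n → Fin 2, (m (hammingWeight x) * (hammingWeight x - 1)) * (x i : ℕ) =
      ∑ k ∈ Finset.univ.erase i, m (hammingWeight x) * ((x i : ℕ) * (x k : ℕ)) := by
    intro x
    rw [← Finset.mul_sum, ← Finset.mul_sum, Finset.sum_erase_eq_sub (Finset.mem_univ i),
      hammingWeight_eq_sum]
    have : ((x i : ℕ) : ℝ) * (x i : ℕ) = (x i : ℕ) := by
      generalize x i = c
      fin_cases c <;> simp
    push_cast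
    linear_combination (m (∑ i, (x i : ℕ))) * this
  rw [Finset.sum_congr rfl fun x _ => hs x, Finset.sum_comm, Finset.sum_congr rfl sym,
    Finset.sum_const, Finset.card_erase_of_mem (Finset.mem_univ i), Finset.card_univ,
    Fintype.card_fin, nsmul_eq_mul, Nat.cast_sub (by have := i.pos; omega)]
  simp

/-! ### The code with weights `0, N` and `3, N + 3` -/

/-- The amplitude of a weight-`w` basis vector in the `k`-th logical basis state on `N + 3`
qubits. -/
def codeAmp (N : ℕ) : Fin 2 → ℕ → ℝ :=
  ![fun w => √(((N : ℝ) - 3) / (2 * N)) * dickeAmp (N + 3) 0 w +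
      √(((N : ℝ) + 3) / (2 * N)) * dickeAmp (N + 3) N w,
    fun w => √(((N : ℝ) + 3) / (2 * N)) * dickeAmp (N + 3) 3 w +
      √(((N : ℝ) - 3) / (2 * N)) * dickeAmp (N + 3) (N + 3) w]

/-- The logical basis states on `N + 3` qubits, for `N` not necessarily a power of two. -/
def dickePair (N : ℕ) (k : Fin 2) : Qubits (N + 3) :=
  WithLp.toLp 2 fun x => (codeAmp N k (hammingWeight x) : ℂ)

theorem dickePair_apply (N : ℕ) (k : Fin 2) (x : Fin (N + 3) → Fin 2) :
    dickePair N k x = (codeAmp N k (hammingWeight x) : ℂ) := rfl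

theorem codeword_eq_dickePair (r : ℕ) (hr : 2 ≤ r) : codeword r = dickePair (2 ^ r) := by
  have h4 : (4 : ℝ) ≤ 2 ^ r := by
    calc (4 : ℝ) = 2 ^ 2 := by norm_num
      _ ≤ 2 ^ r := pow_le_pow_right₀ (by norm_num) hr
  funext k
  ext x
  fin_cases k <;>
  · simp only [codeword, dickePair_apply, codeAmp]
    simp only [Fin.zero_eta, Fin.mk_one, Matrix.cons_val_zero, Matrix.cons_val_one,
      PiLp.smul_apply, PiLp.add_apply, dicke_apply, smul_eq_mul]
    push_cast
    rw [Real.sqrt_div (by linarith), Real.sqrt_div (by linarith), ← pow_succ']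
    push_cast
    ring

theorem codeword11_eq_dickePair : codeword11 = dickePair 8 := by
  have h4 : √(16 : ℝ) = 4 := by
    rw [show (16 : ℝ) = 4 ^ 2 by norm_num]; exact Real.sqrt_sq (by norm_num)
  have h5 : √(((8 : ℕ) - 3 : ℝ) / (2 * (8 : ℕ))) = √5 / 4 := by
    rw [← h4, ← Real.sqrt_div (by norm_num)]; norm_num
  have h11 : √(((8 : ℕ) + 3 : ℝ) / (2 * (8 : ℕ))) = √11 / 4 := by
    rw [← h4, ← Real.sqrt_div (by norm_num)]; norm_num
  funext k
  ext x
  fin_cases k <;>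
  · simp only [codeword11, dickePair_apply, codeAmp, h5, h11]
    simp only [Fin.zero_eta, Fin.mk_one, Matrix.cons_val_zero, Matrix.cons_val_one,
      PiLp.smul_apply, PiLp.add_apply, dicke_apply, smul_eq_mul]
    push_cast
    rfl

theorem dickeAmp_nonneg (n w u : ℕ) : 0 ≤ dickeAmp n w u := by
  rw [dickeAmp]; split_ifs <;> positivity

theorem dickeAmp_pos {n w : ℕ} (hw : w ≤ n) : 0 < dickeAmp n w w := by
  have : (0 : ℝ) < n.choose w := by exact_mod_cast Nat.choose_pos hw
  rw [dickeAmp, if_pos rfl]; positivity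

theorem codeAmp_nonneg (N : ℕ) (k : Fin 2) (w : ℕ) : 0 ≤ codeAmp N k w := by
  fin_cases k <;>
    exact add_nonneg (mul_nonneg (Real.sqrt_nonneg _) (dickeAmp_nonneg ..))
      (mul_nonneg (Real.sqrt_nonneg _) (dickeAmp_nonneg ..))

/-- Any two of the four weights of the code differ by at least three, so an operator on two qubits
connects two basis vectors in the support of the code only if their weights are equal. -/
theorem codeAmp_mul_eq_zero {N : ℕ} (hN : 8 ≤ N) {k l : Fin 2} {w u : ℕ} (h1 : w ≤ u + 2)
    (h2 : u ≤ w + 2) (h : k ≠ l ∨ w ≠ u) : codeAmp N k w * codeAmp N l u = 0 := by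
  fin_cases k <;> fin_cases l <;>
    simp only [codeAmp, dickeAmp, Fin.zero_eta, Fin.mk_one, Matrix.cons_val_zero,
      Matrix.cons_val_one] <;>
    split_ifs <;> first | (exfalso; simp at h; omega) | simp

theorem codeAmp_zero_zero_pos {N : ℕ} (hN : 8 ≤ N) : 0 < codeAmp N 0 0 := by
  have h : (8 : ℝ) ≤ N := by exact_mod_cast hN
  have : 0 < √(((N : ℝ) - 3) / (2 * N)) := Real.sqrt_pos.2 (div_pos (by linarith) (by linarith))
  exact add_pos_of_pos_of_nonneg (mul_pos this (dickeAmp_pos (by omega)))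
    (mul_nonneg (Real.sqrt_nonneg _) (dickeAmp_nonneg ..))

theorem codeAmp_zero_self_pos {N : ℕ} (hN : 8 ≤ N) : 0 < codeAmp N 0 N := by
  have h : (8 : ℝ) ≤ N := by exact_mod_cast hN
  have : 0 < √(((N : ℝ) + 3) / (2 * N)) := Real.sqrt_pos.2 (div_pos (by linarith) (by linarith))
  exact add_pos_of_nonneg_of_pos (mul_nonneg (Real.sqrt_nonneg _) (dickeAmp_nonneg ..))
    (mul_pos this (dickeAmp_pos (by omega)))

theorem codeAmp_one_three_pos {N : ℕ} (hN : 8 ≤ N) : 0 < codeAmp N 1 3 := by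
  have h : (8 : ℝ) ≤ N := by exact_mod_cast hN
  have : 0 < √(((N : ℝ) + 3) / (2 * N)) := Real.sqrt_pos.2 (div_pos (by linarith) (by linarith))
  exact add_pos_of_pos_of_nonneg (mul_pos this (dickeAmp_pos (by omega)))
    (mul_nonneg (Real.sqrt_nonneg _) (dickeAmp_nonneg ..))

theorem sum_sq_dickeAmp_add {n p q : ℕ} (hpq : p ≠ q) (hp : p ≤ n) (hq : q ≤ n) (a b : ℝ)
    (h : ℕ → ℝ) :
    ∑ x : Fin n → Fin 2, (a * dickeAmp n p (hammingWeight x) +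
      b * dickeAmp n q (hammingWeight x)) ^ 2 * h (hammingWeight x) =
      a ^ 2 * h p + b ^ 2 * h q := by
  have e : ∀ u, (a * dickeAmp n p u + b * dickeAmp n q u) ^ 2 * h u =
      a ^ 2 * (dickeAmp n p u ^ 2 * h u) + b ^ 2 * (dickeAmp n q u ^ 2 * h u) := by
    intro u
    have : dickeAmp n p u * dickeAmp n q u = 0 := by
      simp only [dickeAmp]
      split_ifs <;> first | omega | simp
    linear_combination (2 * a * b * h u) * this
  simp only [e, Finset.sum_add_distrib, ← Finset.mul_sum]
  rw [sum_dickeAmp_sq hp, sum_dickeAmp_sq hq]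

theorem sum_codeAmp_zero_sq {N : ℕ} (hN : 8 ≤ N) (h : ℕ → ℝ) :
    ∑ x : Fin (N + 3) → Fin 2, codeAmp N 0 (hammingWeight x) ^ 2 * h (hammingWeight x) =
      ((N : ℝ) - 3) / (2 * N) * h 0 + ((N : ℝ) + 3) / (2 * N) * h N := by
  have h8 : (8 : ℝ) ≤ N := by exact_mod_cast hN
  have := sum_sq_dickeAmp_add (n := N + 3) (p := 0) (q := N) (by omega) (by omega) (by omega)
    (√(((N : ℝ) - 3) / (2 * N))) (√(((N : ℝ) + 3) / (2 * N))) h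
  rwa [Real.sq_sqrt (div_nonneg (by linarith) (by linarith)),
    Real.sq_sqrt (div_nonneg (by linarith) (by linarith))] at this

theorem sum_codeAmp_one_sq {N : ℕ} (hN : 8 ≤ N) (h : ℕ → ℝ) :
    ∑ x : Fin (N + 3) → Fin 2, codeAmp N 1 (hammingWeight x) ^ 2 * h (hammingWeight x) =
      ((N : ℝ) + 3) / (2 * N) * h 3 + ((N : ℝ) - 3) / (2 * N) * h (N + 3) := by
  have h8 : (8 : ℝ) ≤ N := by exact_mod_cast hN
  have := sum_sq_dickeAmp_add (n := N + 3) (p := 3) (q := N + 3) (by omega) (by omega) (by omega)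
    (√(((N : ℝ) + 3) / (2 * N))) (√(((N : ℝ) - 3) / (2 * N))) h
  rwa [Real.sq_sqrt (div_nonneg (by linarith) (by linarith)),
    Real.sq_sqrt (div_nonneg (by linarith) (by linarith))] at this

theorem sum_codeAmp_sq {N : ℕ} (hN : 8 ≤ N) (k : Fin 2) :
    ∑ x : Fin (N + 3) → Fin 2, codeAmp N k (hammingWeight x) ^ 2 = 1 := by
  have h8 : (8 : ℝ) ≤ N := by exact_mod_cast hN
  have h0 := sum_codeAmp_zero_sq hN fun _ => 1
  have h1 := sum_codeAmp_one_sq hN fun _ => 1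
  simp only [mul_one] at h0 h1
  fin_cases k <;> simp only [Fin.zero_eta, Fin.mk_one]
  · rw [h0]; field_simp; ring
  · rw [h1]; field_simp; ring

/-- In both logical basis states every qubit is maximally mixed: this is what the choice of the
coefficients achieves. -/
theorem sum_codeAmp_sq_mul_bit {N : ℕ} (hN : 8 ≤ N) (k : Fin 2) (i : Fin (N + 3)) :
    ∑ x : Fin (N + 3) → Fin 2, codeAmp N k (hammingWeight x) ^ 2 * (x i : ℕ) = 1 / 2 := by
  have h8 : (8 : ℝ) ≤ N := by exact_mod_cast hN
  have key := card_mul_sum_bit (fun w => codeAmp N k w ^ 2) i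
  have hn : ((N + 3 : ℕ) : ℝ) ≠ 0 := by positivity
  apply mul_left_cancel₀ hn
  rw [key]
  have h0 := sum_codeAmp_zero_sq hN fun w => w
  have h1 := sum_codeAmp_one_sq hN fun w => w
  fin_cases k <;> simp only [Fin.zero_eta, Fin.mk_one]
  · rw [h0]; push_cast; field_simp; ring
  · rw [h1]; push_cast; field_simp; ring

/-- The probability of two ones on two qubits is the same in both logical basis states. -/
theorem sum_codeAmp_sq_mul_bit_bit {N : ℕ} (hN : 8 ≤ N) (k : Fin 2) {i j : Fin (N + 3)}
    (hij : i ≠ j) :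
    ∑ x : Fin (N + 3) → Fin 2, codeAmp N k (hammingWeight x) ^ 2 * ((x i : ℕ) * (x j : ℕ)) =
      1 / 2 - 3 / (2 * ((N : ℝ) + 2)) := by
  have h8 : (8 : ℝ) ≤ N := by exact_mod_cast hN
  have key := card_sub_one_mul_sum_bit_bit (fun w => codeAmp N k w ^ 2) hij
  have key2 := card_mul_sum_bit (fun w => codeAmp N k w ^ 2 * (w - 1)) i
  have hn : ((N + 3 : ℕ) : ℝ) ≠ 0 := by positivity
  have hn' : ((N + 3 : ℕ) : ℝ) - 1 ≠ 0 := by push_cast; linarith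
  apply mul_left_cancel₀ hn'
  apply mul_left_cancel₀ hn
  rw [key, key2]
  simp only [mul_assoc]
  have h0 := sum_codeAmp_zero_sq hN fun w => ((w : ℝ) - 1) * w
  have h1 := sum_codeAmp_one_sq hN fun w => ((w : ℝ) - 1) * w
  fin_cases k <;> simp only [Fin.zero_eta, Fin.mk_one]
  · rw [h0]; push_cast; field_simp; ring
  · rw [h1]; push_cast; field_simp; ring

/-! ### One-site operators -/

/-- The operator acting as `A` on qubit `i` and as the identity on the other qubits. -/
def siteOp {n : ℕ} (i : Fin n) (A : Matrix (Fin 2) (Fin 2) ℂ) : QubitOp n :=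
  tensorOp (Function.update (fun _ => 1) i A)

theorem siteOp_mulVec {n : ℕ} (i : Fin n) (A : Matrix (Fin 2) (Fin 2) ℂ)
    (v : (Fin n → Fin 2) → ℂ) (x : Fin n → Fin 2) :
    (siteOp i A *ᵥ v) x = ∑ c, A (x i) c * v (Function.update x i c) := by
  symm
  refine Finset.sum_of_injOn (fun c => Function.update x i c) ?_ (fun _ _ => by simp) ?_ ?_
  · intro c _ d _ h
    exact Function.update_injective x i h
  · intro y _ hy
    obtain ⟨k, hk, hxy⟩ : ∃ k, k ≠ i ∧ x k ≠ y k := by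
      by_contra! hcon
      refine hy ⟨y i, by simp, ?_⟩
      funext k
      by_cases hk : k = i
      · subst hk; simp
      · simp [Function.update_of_ne hk, hcon k hk]
    have : siteOp i A x y = 0 := Finset.prod_eq_zero (Finset.mem_univ k) (by
      rw [Function.update_of_ne hk]; exact Matrix.one_apply_ne hxy)
    simp [this]
  · intro c _
    have : siteOp i A x (Function.update x i c) = A (x i) c := by
      rw [siteOp, tensorOp, Matrix.of_apply, ← Finset.mul_prod_erase _ _ (Finset.mem_univ i),
        Finset.prod_eq_one fun k hk => by
          rw [Function.update_of_ne (Finset.ne_of_mem_erase hk),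
            Function.update_of_ne (Finset.ne_of_mem_erase hk), Matrix.one_apply_eq]]
      simp
    simp [this]

theorem siteOp_one {n : ℕ} (i : Fin n) : siteOp i 1 = 1 := by
  rw [siteOp, ← tensorOp_one]
  congr 1
  exact Function.update_eq_self i _

theorem siteOp_mul {n : ℕ} (i : Fin n) (A B : Matrix (Fin 2) (Fin 2) ℂ) :
    siteOp i A * siteOp i B = siteOp i (A * B) := by
  rw [siteOp, siteOp, siteOp, tensorOp_mul]
  congr 1
  funext k
  by_cases hk : k = i
  · subst hk; simp
  · simp [Function.update_of_ne hk]

theorem siteOp_commute {n : ℕ} {i j : Fin n} (hij : i ≠ j) (A B : Matrix (Fin 2) (Fin 2) ℂ) :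
    siteOp i A * siteOp j B = siteOp j B * siteOp i A := by
  rw [siteOp, siteOp, tensorOp_mul, tensorOp_mul]
  congr 1
  funext k
  by_cases hk : k = i
  · subst hk; simp [Function.update_of_ne hij]
  · simp [Function.update_of_ne hk]

theorem tensorOp_conjTranspose {n : ℕ} (T : Fin n → Matrix (Fin 2) (Fin 2) ℂ) :
    (tensorOp T)ᴴ = tensorOp fun i => (T i)ᴴ := by
  ext x y
  simp [tensorOp, Matrix.conjTranspose_apply]

theorem tensorOp_conjTranspose_mul_self {n : ℕ} (U : Fin n → Matrix.unitaryGroup (Fin 2) ℂ) :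
    (tensorOp fun i => (U i : Matrix (Fin 2) (Fin 2) ℂ))ᴴ *
      tensorOp (fun i => (U i : Matrix (Fin 2) (Fin 2) ℂ)) = 1 := by
  rw [tensorOp_conjTranspose, tensorOp_mul, ← tensorOp_one]
  congr 1
  funext i
  exact Matrix.UnitaryGroup.star_mul_self (U i)

theorem tensorOp_conj_siteOp {n : ℕ} (U : Fin n → Matrix.unitaryGroup (Fin 2) ℂ) (i : Fin n)
    (A : Matrix (Fin 2) (Fin 2) ℂ) :
    siteOp i A * tensorOp (fun i => (U i : Matrix (Fin 2) (Fin 2) ℂ)) =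
      tensorOp (fun i => (U i : Matrix (Fin 2) (Fin 2) ℂ)) *
        siteOp i ((U i : Matrix (Fin 2) (Fin 2) ℂ)ᴴ * A * (U i : Matrix (Fin 2) (Fin 2) ℂ)) := by
  rw [siteOp, siteOp, tensorOp_mul, tensorOp_mul]
  congr 1
  funext k
  by_cases hk : k = i
  · subst hk
    have : (U k : Matrix (Fin 2) (Fin 2) ℂ) * (U k : Matrix (Fin 2) (Fin 2) ℂ)ᴴ = 1 :=
      Matrix.mem_unitaryGroup_iff.1 (U k).2
    simp only [Function.update_self, ← Matrix.mul_assoc, this, Matrix.one_mul]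
  · simp [Function.update_of_ne hk]

/-- Moving a two-site operator through a local unitary gate conjugates both factors. -/
theorem siteOp_mul_siteOp_mul_tensorOp {n : ℕ} (U : Fin n → Matrix.unitaryGroup (Fin 2) ℂ)
    (i j : Fin n) (A B : Matrix (Fin 2) (Fin 2) ℂ) :
    siteOp i A * siteOp j B * tensorOp (fun i => (U i : Matrix (Fin 2) (Fin 2) ℂ)) =
      tensorOp (fun i => (U i : Matrix (Fin 2) (Fin 2) ℂ)) *
        (siteOp i ((U i : Matrix (Fin 2) (Fin 2) ℂ)ᴴ * A * (U i : Matrix (Fin 2) (Fin 2) ℂ)) *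
         siteOp j ((U j : Matrix (Fin 2) (Fin 2) ℂ)ᴴ * B * (U j : Matrix (Fin 2) (Fin 2) ℂ))) := by
  rw [Matrix.mul_assoc, tensorOp_conj_siteOp, ← Matrix.mul_assoc, tensorOp_conj_siteOp,
    Matrix.mul_assoc]

theorem siteOp_pauli_mul_siteOp_pauli {n : ℕ} {i j : Fin n} (hij : i ≠ j) (s : Fin n → Fin 4)
    (hs : ∀ k, s k ≠ 0 → k = i ∨ k = j) :
    pauliString s = siteOp i (pauli (s i)) * siteOp j (pauli (s j)) := by
  rw [pauliString, siteOp, siteOp, tensorOp_mul]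
  congr 1
  funext k
  by_cases hk : k = i
  · subst hk; simp [Function.update_of_ne hij]
  · by_cases hk' : k = j
    · subst hk'; simp [Function.update_of_ne hk]
    · have : s k = 0 := by
        by_contra h
        exact (hs k h).elim hk hk'
      simp [Function.update_of_ne hk, Function.update_of_ne hk', this, pauli]

theorem exists_pauliString_eq_siteOp_mul_siteOp {n : ℕ} (hn : 2 ≤ n) (s : Fin n → Fin 4)
    (hs : weight s < 3) : ∃ i j : Fin n, i ≠ j ∧
      pauliString s = siteOp i (pauli (s i)) * siteOp j (pauli (s j)) := by
  obtain ⟨T, hT, hc⟩ := Finset.exists_superset_card_eq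
    (s := Finset.univ.filter fun i => s i ≠ 0) (n := 2) (by rw [weight] at hs; omega) (by simpa)
  obtain ⟨i, j, hij, rfl⟩ := Finset.card_eq_two.1 hc
  refine ⟨i, j, hij, siteOp_pauli_mul_siteOp_pauli hij s fun k hk => ?_⟩
  have := hT (Finset.mem_filter.2 ⟨Finset.mem_univ k, hk⟩)
  simpa using this

/-! ### Two-site correlations of the code -/

/-- The expectation value of `A ⊗ B` on two qubits in every normalized codeword. -/
def corr (N : ℕ) (A B : Matrix (Fin 2) (Fin 2) ℂ) : ℂ :=
  (1 / 2 - 3 / (2 * ((N : ℂ) + 2))) * (A 0 0 * B 0 0 + A 1 1 * B 1 1) +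
    3 / (2 * ((N : ℂ) + 2)) * (A 0 0 * B 1 1 + A 1 1 * B 0 0 + A 0 1 * B 1 0 + A 1 0 * B 0 1)

theorem ofLp_toEuclideanLin {n : ℕ} (M : QubitOp n) (v : Qubits n) :
    (Matrix.toEuclideanLin M v).ofLp = M *ᵥ v.ofLp := by
  rw [Matrix.ofLp_toLpLin, Matrix.toLin'_apply]

theorem toEuclideanLin_mul_apply {n : ℕ} (M M' : QubitOp n) (v : Qubits n) :
    Matrix.toEuclideanLin (M * M') v = Matrix.toEuclideanLin M (Matrix.toEuclideanLin M' v) := by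
  apply WithLp.ofLp_injective
  simp only [ofLp_toEuclideanLin, Matrix.mulVec_mulVec]

theorem toEuclideanLin_one_apply {n : ℕ} (v : Qubits n) :
    Matrix.toEuclideanLin (1 : QubitOp n) v = v := by
  apply WithLp.ofLp_injective
  rw [ofLp_toEuclideanLin, Matrix.one_mulVec]

theorem inner_toEuclideanLin {n : ℕ} (u v : Qubits n) (M : QubitOp n) :
    inner ℂ u (Matrix.toEuclideanLin M v) = ∑ x, star (u x) * (M *ᵥ v.ofLp) x := by
  rw [EuclideanSpace.inner_eq_star_dotProduct, ofLp_toEuclideanLin, dotProduct]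
  refine Finset.sum_congr rfl fun x _ => ?_
  rw [mul_comm]
  rfl

/-- The contribution of a basis vector with bits `b`, `c` on two qubits to the expectation value of
`A ⊗ B`: the total weight of the two bits is preserved. -/
def pairKernel (A B : Matrix (Fin 2) (Fin 2) ℂ) (b c : Fin 2) : ℂ :=
  ∑ b' : Fin 2, ∑ c' : Fin 2, if (b : ℕ) + c = b' + c' then A b b' * B c c' else 0

theorem pairKernel_eq (A B : Matrix (Fin 2) (Fin 2) ℂ) (b c : Fin 2) :
    pairKernel A B b c = A 0 0 * B 0 0 +
      (A 0 0 * B 1 1 + A 0 1 * B 1 0 - A 0 0 * B 0 0) * ((c : ℕ) : ℂ) +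
      (A 1 1 * B 0 0 + A 1 0 * B 0 1 - A 0 0 * B 0 0) * ((b : ℕ) : ℂ) +
      (A 0 0 * B 0 0 + A 1 1 * B 1 1 - A 0 0 * B 1 1 - A 1 1 * B 0 0 - A 0 1 * B 1 0
        - A 1 0 * B 0 1) * (((b : ℕ) : ℂ) * ((c : ℕ) : ℂ)) := by
  fin_cases b <;> fin_cases c <;> simp [pairKernel, Fin.sum_univ_two] <;> ring

/-- The matrix elements of every two-site operator between the logical basis states. This single
formula contains orthonormality, the Knill–Laflamme conditions for errors of weight at most two, and
the correlations that determine the local symmetries of the code. -/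
theorem inner_siteOp_mul_siteOp {N : ℕ} (hN : 8 ≤ N) (k l : Fin 2) {i j : Fin (N + 3)}
    (hij : i ≠ j) (A B : Matrix (Fin 2) (Fin 2) ℂ) :
    inner ℂ (dickePair N k) (Matrix.toEuclideanLin (siteOp i A * siteOp j B) (dickePair N l)) =
      if k = l then corr N A B else 0 := by
  have expand : ∀ x : Fin (N + 3) → Fin 2,
      star (dickePair N k x) * ((siteOp i A * siteOp j B) *ᵥ (dickePair N l).ofLp) x =
        if k = l then ((codeAmp N k (hammingWeight x) ^ 2 : ℝ) : ℂ) * pairKernel A B (x i) (x j)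
        else 0 := by
    intro x
    have hw : ∀ b c : Fin 2, hammingWeight (Function.update (Function.update x i b) j c) +
        ((x i : ℕ) + x j) = hammingWeight x + (b + c) := by
      intro b c
      have h1 := hammingWeight_update (Function.update x i b) j c
      have h2 := hammingWeight_update x i b
      rw [Function.update_of_ne hij.symm] at h1
      omega
    have term : ∀ b c : Fin 2, star (dickePair N k x) * (A (x i) b * (B (x j) c *
        dickePair N l (Function.update (Function.update x i b) j c))) =
        if k = l then ((codeAmp N k (hammingWeight x) ^ 2 : ℝ) : ℂ) *
          (if (x i : ℕ) + x j = b + c then A (x i) b * B (x j) c else 0) else 0 := by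
      intro b c
      have e : star (dickePair N k x) = (codeAmp N k (hammingWeight x) : ℂ) := by
        rw [dickePair_apply]; exact Complex.conj_ofReal _
      rw [e, dickePair_apply]
      have hbc := hw b c
      by_cases hkl : k = l ∧ (x i : ℕ) + x j = b + c
      · obtain ⟨rfl, h⟩ := hkl
        rw [if_pos rfl, if_pos h, show hammingWeight (Function.update (Function.update x i b) j c) =
          hammingWeight x by omega]
        push_cast
        ring
      · have hz : codeAmp N k (hammingWeight x) *
            codeAmp N l (hammingWeight (Function.update (Function.update x i b) j c)) = 0 := by
          have := (x i).isLt
          have := (x j).isLt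
          refine codeAmp_mul_eq_zero hN (by omega) (by omega) ?_
          by_contra! hcon
          exact hkl ⟨hcon.1, by omega⟩
        have hz' := congrArg (fun r : ℝ => (r : ℂ)) hz
        push_cast at hz'
        have hR : (if k = l then ((codeAmp N k (hammingWeight x) ^ 2 : ℝ) : ℂ) *
          (if (x i : ℕ) + x j = b + c then A (x i) b * B (x j) c else 0) else 0) = 0 := by
          by_cases h1 : k = l
          · rw [if_neg fun h2 => hkl ⟨h1, h2⟩]; simp
          · rw [if_neg h1]
        rw [hR]
        linear_combination (A (x i) b * B (x j) c) * hz'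
    rw [← Matrix.mulVec_mulVec, siteOp_mulVec, Finset.mul_sum]
    simp only [siteOp_mulVec, Function.update_of_ne hij.symm, Finset.mul_sum, term]
    split_ifs with hkl
    · simp only [pairKernel, Finset.mul_sum]
    · simp
  rw [inner_toEuclideanLin, Finset.sum_congr rfl fun x _ => expand x]
  split_ifs with hkl
  · have m0 := congrArg (fun r : ℝ => (r : ℂ)) (sum_codeAmp_sq hN k)
    have mi := congrArg (fun r : ℝ => (r : ℂ)) (sum_codeAmp_sq_mul_bit hN k i)
    have mj := congrArg (fun r : ℝ => (r : ℂ)) (sum_codeAmp_sq_mul_bit hN k j)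
    have mij := congrArg (fun r : ℝ => (r : ℂ)) (sum_codeAmp_sq_mul_bit_bit hN k hij)
    push_cast at m0 mi mj mij
    have split : ∀ x : Fin (N + 3) → Fin 2,
        ((codeAmp N k (hammingWeight x) ^ 2 : ℝ) : ℂ) * pairKernel A B (x i) (x j) =
        A 0 0 * B 0 0 * (codeAmp N k (hammingWeight x) : ℂ) ^ 2 +
        (A 0 0 * B 1 1 + A 0 1 * B 1 0 - A 0 0 * B 0 0) *
          ((codeAmp N k (hammingWeight x) : ℂ) ^ 2 * ((x j : ℕ) : ℂ)) +
        (A 1 1 * B 0 0 + A 1 0 * B 0 1 - A 0 0 * B 0 0) *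
          ((codeAmp N k (hammingWeight x) : ℂ) ^ 2 * ((x i : ℕ) : ℂ)) +
        (A 0 0 * B 0 0 + A 1 1 * B 1 1 - A 0 0 * B 1 1 - A 1 1 * B 0 0 - A 0 1 * B 1 0
          - A 1 0 * B 0 1) *
          ((codeAmp N k (hammingWeight x) : ℂ) ^ 2 * (((x i : ℕ) : ℂ) * ((x j : ℕ) : ℂ))) := by
      intro x
      rw [pairKernel_eq]
      push_cast
      ring
    simp only [split, Finset.sum_add_distrib, ← Finset.mul_sum]
    rw [m0, mi, mj, mij, corr]
    ring
  · simp

theorem orthonormal_dickePair {N : ℕ} (hN : 8 ≤ N) : Orthonormal ℂ (dickePair N) := by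
  rw [orthonormal_iff_ite]
  intro k l
  have h := inner_siteOp_mul_siteOp hN k l (i := 0) (j := 1) (by simp) 1 1
  rw [siteOp_one, siteOp_one, Matrix.one_mul] at h
  rw [toEuclideanLin_one_apply] at h
  rw [h]
  have : corr N 1 1 = 1 := by simp [corr]; ring
  rw [this]

/-- The Knill–Laflamme condition for an arbitrary operator on two qubits. -/
theorem inner_siteOp_mul_siteOp_of_mem {N : ℕ} (hN : 8 ≤ N) {i j : Fin (N + 3)} (hij : i ≠ j)
    (A B : Matrix (Fin 2) (Fin 2) ℂ) {u v : Qubits (N + 3)} (hu : u ∈ codespace (dickePair N))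
    (hv : v ∈ codespace (dickePair N)) :
    inner ℂ u (Matrix.toEuclideanLin (siteOp i A * siteOp j B) v) = corr N A B * inner ℂ u v := by
  have hon := orthonormal_iff_ite.1 (orthonormal_dickePair hN)
  obtain ⟨a, rfl⟩ := (Submodule.mem_span_range_iff_exists_fun ℂ).1 hu
  obtain ⟨b, rfl⟩ := (Submodule.mem_span_range_iff_exists_fun ℂ).1 hv
  simp only [Fin.sum_univ_two, map_add, map_smul, inner_add_left, inner_add_right, inner_smul_left,
    inner_smul_right, inner_siteOp_mul_siteOp hN _ _ hij, hon]
  simp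
  ring

theorem finrank_codespace_dickePair {N : ℕ} (hN : 8 ≤ N) :
    Module.finrank ℂ (codespace (dickePair N)) = 2 := by
  rw [codespace, finrank_span_eq_card (orthonormal_dickePair hN).linearIndependent,
    Fintype.card_fin]

theorem pauli_one_apply_nonneg (c : Fin 4) (hc : c = 0 ∨ c = 1) (a b : Fin 2) :
    ∃ r : ℝ, 0 ≤ r ∧ pauli c a b = r := by
  rcases hc with rfl | rfl <;> fin_cases a <;> fin_cases b <;>
    first
    | (refine ⟨0, le_rfl, ?_⟩; simp [pauli]; done)
    | (refine ⟨1, zero_le_one, ?_⟩; simp [pauli])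

theorem isCode_dickePair {N : ℕ} (hN : 8 ≤ N) : IsCode (codespace (dickePair N)) 2 3 := by
  refine ⟨finrank_codespace_dickePair hN, ?_, ?_⟩
  · intro s hs
    obtain ⟨i, j, hij, e⟩ := exists_pauliString_eq_siteOp_mul_siteOp (by omega) s hs
    refine ⟨corr N (pauli (s i)) (pauli (s j)), fun u hu v hv => ?_⟩
    rw [e]
    exact inner_siteOp_mul_siteOp_of_mem hN hij _ _ hu hv
  · -- `X ⊗ X ⊗ X` on three qubits maps `|D_0⟩` into `|D_3⟩`, and all matrix elements between the
    -- logical basis states are nonnegative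
    intro e he
    by_contra! hlt
    obtain ⟨S, hS⟩ : ∃ S : Finset (Fin (N + 3)), S.card = 3 := by
      obtain ⟨S, -, hS⟩ := Finset.exists_subset_card_eq (s := (Finset.univ : Finset (Fin (N + 3))))
        (n := 3) (by simp)
      exact ⟨S, hS⟩
    set s : Fin (N + 3) → Fin 4 := fun i => if i ∈ S then 1 else 0 with hs
    have hwt : weight s = 3 := by
      refine (congrArg Finset.card ?_).trans hS
      ext i
      by_cases h : i ∈ S <;> simp [hs, h]
    obtain ⟨c, hc⟩ := he s (by omega)
    have h0 := hc (dickePair N 0) (Submodule.subset_span ⟨0, rfl⟩) (dickePair N 1)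
      (Submodule.subset_span ⟨1, rfl⟩)
    rw [(orthonormal_dickePair hN).inner_eq_zero (by simp), mul_zero, inner_toEuclideanLin] at h0
    have hent : ∀ x y : Fin (N + 3) → Fin 2, ∃ r : ℝ, 0 ≤ r ∧ pauliString s x y = r := by
      intro x y
      choose f hf0 hf using fun i => pauli_one_apply_nonneg (s i)
        (by by_cases h : i ∈ S <;> simp [hs, h]) (x i) (y i)
      exact ⟨∏ i, f i, Finset.prod_nonneg fun i _ => hf0 i, by
        simp only [pauliString, tensorOp, Matrix.of_apply, hf]; push_cast; rfl⟩
    choose R hR0 hR using hent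
    have hcorner : R (fun _ => 0) (bitString S) = 1 := by
      have h1 : pauliString s (fun _ => 0) (bitString S) = 1 := by
        simp only [pauliString, tensorOp, Matrix.of_apply]
        refine Finset.prod_eq_one fun i _ => ?_
        by_cases h : i ∈ S <;> simp [hs, h, bitString, pauli]
      rw [hR] at h1
      exact_mod_cast h1
    have hreal : ∑ x, ∑ y, codeAmp N 0 (hammingWeight x) * (R x y * codeAmp N 1 (hammingWeight y))
        = 0 := by
      rw [← Complex.ofReal_inj, Complex.ofReal_zero, ← h0]
      push_cast
      refine Finset.sum_congr rfl fun x _ => ?_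
      rw [Matrix.mulVec, dotProduct, Finset.mul_sum]
      refine Finset.sum_congr rfl fun y _ => ?_
      rw [hR, dickePair_apply, dickePair_apply]
      congr 1
      exact (Complex.conj_ofReal _).symm
    have hnn : ∀ x y, 0 ≤ codeAmp N 0 (hammingWeight x) * (R x y * codeAmp N 1 (hammingWeight y)) :=
      fun x y => mul_nonneg (codeAmp_nonneg ..) (mul_nonneg (hR0 x y) (codeAmp_nonneg ..))
    have h1 := (Finset.sum_eq_zero_iff_of_nonneg fun x _ =>
      Finset.sum_nonneg fun y _ => hnn x y).1 hreal (fun _ => 0) (Finset.mem_univ _)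
    have h2 := (Finset.sum_eq_zero_iff_of_nonneg fun y _ => hnn _ y).1 h1 (bitString S)
      (Finset.mem_univ _)
    have hz : hammingWeight (fun _ : Fin (N + 3) => (0 : Fin 2)) = 0 := by simp [hammingWeight]
    rw [hcorner, hammingWeight_bitString, hS, hz, one_mul] at h2
    exact (mul_pos (codeAmp_zero_zero_pos hN) (codeAmp_one_three_pos hN)).ne' h2

theorem permuteQubits_dickePair {N : ℕ} (σ : Equiv.Perm (Fin (N + 3))) (k : Fin 2) :
    permuteQubits σ (dickePair N k) = dickePair N k := by
  ext x
  have : permuteQubits σ (dickePair N k) x = dickePair N k (x ∘ σ) := rfl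
  rw [this, dickePair_apply, dickePair_apply, hammingWeight_comp_perm]

theorem isPermutationInvariant_dickePair (N : ℕ) :
    IsPermutationInvariant (codespace (dickePair N)) := by
  intro v hv σ
  obtain ⟨a, rfl⟩ := (Submodule.mem_span_range_iff_exists_fun ℂ).1 hv
  simp only [map_sum, map_smul, permuteQubits_dickePair]

/-! ### Correlations of traceless Hermitian involutions -/

/-- A Hermitian traceless `2 × 2` involution is given by its Bloch vector `(Re y, -Im y, x)`. -/
theorem exists_bloch {A : Matrix (Fin 2) (Fin 2) ℂ} (hA : Aᴴ = A) (htr : A.trace = 0)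
    (hsq : A * A = 1) :
    ∃ (x : ℝ) (y : ℂ), A = !![(x : ℂ), y; star y, -(x : ℂ)] ∧
      x ^ 2 + (y.re ^ 2 + y.im ^ 2) = 1 := by
  have h00 : star (A 0 0) = A 0 0 := congrFun (congrFun hA 0) 0
  have h10 : star (A 0 1) = A 1 0 := congrFun (congrFun hA 1) 0
  obtain ⟨x, hx⟩ := Complex.conj_eq_iff_real.1 h00
  have h11 : A 1 1 = -A 0 0 := by
    rw [Matrix.trace_fin_two] at htr
    linear_combination htr
  refine ⟨x, A 0 1, ?_, ?_⟩
  · ext i j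
    fin_cases i <;> fin_cases j <;> simp [hx, h11, ← h10]
  · have := congrFun (congrFun hsq 0) 0
    rw [Matrix.mul_apply, Fin.sum_univ_two, ← h10, hx, Matrix.one_apply_eq] at this
    have hre := congrArg Complex.re this
    simp at hre
    linarith

theorem pauli_conjTranspose (a : Fin 4) : (pauli a)ᴴ = pauli a := by
  ext i j
  fin_cases a <;> fin_cases i <;> fin_cases j <;> simp [pauli, Matrix.conjTranspose_apply]

theorem pauli_mul_self (a : Fin 4) : pauli a * pauli a = 1 := by
  ext i j
  fin_cases a <;> fin_cases i <;> fin_cases j <;>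
    simp [pauli, Matrix.mul_apply, Fin.sum_univ_two]

theorem pauli_trace {a : Fin 4} (ha : a ≠ 0) : (pauli a).trace = 0 := by
  fin_cases a <;> simp [pauli, Matrix.trace_fin_two] at ha ⊢

theorem conj_pauli_mul_self (U : Matrix.unitaryGroup (Fin 2) ℂ) (a : Fin 4) :
    ((U : Matrix (Fin 2) (Fin 2) ℂ)ᴴ * pauli a * U) *
      ((U : Matrix (Fin 2) (Fin 2) ℂ)ᴴ * pauli a * U) = 1 := by
  have h1 : (U : Matrix (Fin 2) (Fin 2) ℂ) * (U : Matrix (Fin 2) (Fin 2) ℂ)ᴴ = 1 :=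
    Matrix.mem_unitaryGroup_iff.1 U.2
  have h2 : (U : Matrix (Fin 2) (Fin 2) ℂ)ᴴ * (U : Matrix (Fin 2) (Fin 2) ℂ) = 1 :=
    Matrix.UnitaryGroup.star_mul_self U
  calc _ = (U : Matrix (Fin 2) (Fin 2) ℂ)ᴴ * (pauli a * ((U : Matrix (Fin 2) (Fin 2) ℂ) *
        (U : Matrix (Fin 2) (Fin 2) ℂ)ᴴ) * pauli a) * U := by simp only [Matrix.mul_assoc]
    _ = 1 := by rw [h1, Matrix.mul_one, pauli_mul_self, Matrix.mul_one, h2]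

theorem exists_bloch_conj_pauli (U : Matrix.unitaryGroup (Fin 2) ℂ) {a : Fin 4} (ha : a ≠ 0) :
    ∃ (x : ℝ) (y : ℂ), (U : Matrix (Fin 2) (Fin 2) ℂ)ᴴ * pauli a * U =
      !![(x : ℂ), y; star y, -(x : ℂ)] ∧ x ^ 2 + (y.re ^ 2 + y.im ^ 2) = 1 := by
  refine exists_bloch ?_ ?_ (conj_pauli_mul_self U a)
  · simp only [Matrix.conjTranspose_mul, Matrix.conjTranspose_conjTranspose, pauli_conjTranspose,
      Matrix.mul_assoc]
  · have h1 : (U : Matrix (Fin 2) (Fin 2) ℂ) * (U : Matrix (Fin 2) (Fin 2) ℂ)ᴴ = 1 :=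
      Matrix.mem_unitaryGroup_iff.1 U.2
    rw [Matrix.trace_mul_comm, ← Matrix.mul_assoc, h1, Matrix.one_mul, pauli_trace ha]

/-- In terms of Bloch vectors the correlation form is diagonal, with eigenvalue `3 / (N + 2)` in the
`x` and `y` directions and `(N - 4) / (N + 2)` in the `z` direction. -/
theorem corr_bloch (N : ℕ) (x x' : ℝ) (y y' : ℂ) :
    corr N !![(x : ℂ), y; star y, -(x : ℂ)] !![(x' : ℂ), y'; star y', -(x' : ℂ)] =
      (((((N : ℝ) - 4) * (x * x') + 3 * (y.re * y'.re + y.im * y'.im)) / ((N : ℝ) + 2) : ℝ) :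
        ℂ) := by
  have hN : (N : ℂ) + 2 ≠ 0 := by exact_mod_cast Nat.succ_ne_zero (N + 1)
  have hy : y * star y' + star y * y' = ((2 * (y.re * y'.re + y.im * y'.im) : ℝ) : ℂ) := by
    apply Complex.ext <;> simp <;> ring
  simp only [corr, Matrix.of_apply, Matrix.cons_val_zero, Matrix.cons_val_one, Matrix.cons_val',
    Matrix.cons_val_fin_one]
  push_cast at hy ⊢
  field_simp
  linear_combination 3 * hy

theorem corr_bloch_ne_one {N : ℕ} (hN : 8 ≤ N) {x x' : ℝ} {y y' : ℂ}
    (h : x ^ 2 + (y.re ^ 2 + y.im ^ 2) = 1) (h' : x' ^ 2 + (y'.re ^ 2 + y'.im ^ 2) = 1) :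
    ((((N : ℝ) - 4) * (x * x') + 3 * (y.re * y'.re + y.im * y'.im)) / ((N : ℝ) + 2)) ^ 2 ≠ 1 := by
  have h8 : (8 : ℝ) ≤ N := by exact_mod_cast hN
  have hp : (0 : ℝ) < N + 2 := by linarith
  intro hcon
  rw [pow_two] at hcon
  rcases mul_self_eq_one_iff.1 hcon with e | e
  all_goals
    rw [div_eq_iff hp.ne'] at e
    nlinarith [sq_nonneg (x - x'), sq_nonneg (x + x'), sq_nonneg (y.re - y'.re),
      sq_nonneg (y.re + y'.re), sq_nonneg (y.im - y'.im), sq_nonneg (y.im + y'.im)]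

/-- The `z` direction is the unique direction of largest correlation. -/
theorem eq_zero_of_corr_bloch_eq {N : ℕ} (hN : 8 ≤ N) {x x' : ℝ} {y y' : ℂ}
    (h : x ^ 2 + (y.re ^ 2 + y.im ^ 2) = 1) (h' : x' ^ 2 + (y'.re ^ 2 + y'.im ^ 2) = 1)
    (he : (((N : ℝ) - 4) * (x * x') + 3 * (y.re * y'.re + y.im * y'.im)) / ((N : ℝ) + 2) =
      ((N : ℝ) - 4) / ((N : ℝ) + 2)) : y = 0 ∧ y' = 0 ∧ x * x' = 1 := by
  have h8 : (8 : ℝ) ≤ N := by exact_mod_cast hN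
  have hp : (0 : ℝ) < N + 2 := by linarith
  rw [div_left_inj' hp.ne'] at he
  have h1 : (y.re ^ 2 + y.im ^ 2) + (y'.re ^ 2 + y'.im ^ 2) ≤ 0 := by
    have : ((N : ℝ) - 7) * ((y.re ^ 2 + y.im ^ 2) + (y'.re ^ 2 + y'.im ^ 2)) ≤ 0 := by
      nlinarith [mul_nonneg (by linarith : (0 : ℝ) ≤ N - 4) (sq_nonneg (x - x')),
        sq_nonneg (y.re - y'.re), sq_nonneg (y.im - y'.im)]
    nlinarith [sq_nonneg y.re, sq_nonneg y.im, sq_nonneg y'.re, sq_nonneg y'.im]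
  have s1 := sq_nonneg y.re
  have s2 := sq_nonneg y.im
  have s3 := sq_nonneg y'.re
  have s4 := sq_nonneg y'.im
  have a1 : y.re = 0 := pow_eq_zero_iff two_ne_zero |>.1 (by linarith)
  have a2 : y.im = 0 := pow_eq_zero_iff two_ne_zero |>.1 (by linarith)
  have a3 : y'.re = 0 := pow_eq_zero_iff two_ne_zero |>.1 (by linarith)
  have a4 : y'.im = 0 := pow_eq_zero_iff two_ne_zero |>.1 (by linarith)
  refine ⟨Complex.ext a1 a2, Complex.ext a3 a4, ?_⟩
  rw [a1, a2] at he
  have hne : (N : ℝ) - 4 ≠ 0 := by linarith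
  apply mul_left_cancel₀ hne
  linarith

theorem corr_lin_left (N : ℕ) (a b c : ℂ) (A A' A'' B : Matrix (Fin 2) (Fin 2) ℂ) :
    corr N (a • A + b • A' + c • A'') B = a * corr N A B + b * corr N A' B + c * corr N A'' B := by
  simp only [corr, Matrix.add_apply, Matrix.smul_apply, smul_eq_mul]
  ring

theorem corr_lin_right (N : ℕ) (a b c : ℂ) (A B B' B'' : Matrix (Fin 2) (Fin 2) ℂ) :
    corr N A (a • B + b • B' + c • B'') = a * corr N A B + b * corr N A B' + c * corr N A B'' := by
  simp only [corr, Matrix.add_apply, Matrix.smul_apply, smul_eq_mul]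
  ring

theorem exists_eq_lin_comb_conj_pauli (U : Matrix.unitaryGroup (Fin 2) ℂ)
    {A : Matrix (Fin 2) (Fin 2) ℂ} (hA : A.trace = 0) : ∃ a b c : ℂ,
      A = a • ((U : Matrix (Fin 2) (Fin 2) ℂ)ᴴ * pauli 1 * U) +
        b • ((U : Matrix (Fin 2) (Fin 2) ℂ)ᴴ * pauli 2 * U) +
        c • ((U : Matrix (Fin 2) (Fin 2) ℂ)ᴴ * pauli 3 * U) := by
  have h2 : (U : Matrix (Fin 2) (Fin 2) ℂ)ᴴ * (U : Matrix (Fin 2) (Fin 2) ℂ) = 1 :=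
    Matrix.UnitaryGroup.star_mul_self U
  set M := (U : Matrix (Fin 2) (Fin 2) ℂ) * A * (U : Matrix (Fin 2) (Fin 2) ℂ)ᴴ with hM
  have htr : M 0 0 + M 1 1 = 0 := by
    rw [← Matrix.trace_fin_two, hM, Matrix.trace_mul_comm, ← Matrix.mul_assoc, h2, Matrix.one_mul,
      hA]
  have hMP : M = ((M 0 1 + M 1 0) / 2) • pauli 1 + (Complex.I * (M 0 1 - M 1 0) / 2) • pauli 2 +
      M 0 0 • pauli 3 := by
    ext i j
    fin_cases i <;> fin_cases j <;> simp [pauli]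
    · linear_combination ((M 0 1 - M 1 0) / 2) * Complex.I_sq
    · linear_combination (-(M 0 1 - M 1 0) / 2) * Complex.I_sq
    · linear_combination htr
  -- the coefficients are those of `M = U A Uᴴ` in the Pauli basis
  refine ⟨(M 0 1 + M 1 0) / 2, Complex.I * (M 0 1 - M 1 0) / 2, M 0 0, ?_⟩
  calc A = (U : Matrix (Fin 2) (Fin 2) ℂ)ᴴ * M * U := by
        rw [hM]
        calc A = ((U : Matrix (Fin 2) (Fin 2) ℂ)ᴴ * U) * A *
              ((U : Matrix (Fin 2) (Fin 2) ℂ)ᴴ * U) := by rw [h2, Matrix.one_mul, Matrix.mul_one]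
          _ = _ := by simp only [Matrix.mul_assoc]
    _ = _ := by
        conv_lhs => rw [hMP]
        simp only [Matrix.mul_add, Matrix.add_mul, Matrix.mul_smul, Matrix.smul_mul]

/-! ### The code is not equivalent to a stabilizer code -/

theorem tensorOp_smul {n : ℕ} (ε : Fin n → ℂ) (A : Fin n → Matrix (Fin 2) (Fin 2) ℂ) :
    tensorOp (fun i => ε i • A i) = (∏ i, ε i) • tensorOp A := by
  ext x y
  simp [tensorOp, Finset.prod_mul_distrib]

theorem pauli_mul_comm_or (a b : Fin 4) :
    ∃ ε : ℂ, (ε = 1 ∨ ε = -1) ∧ pauli a * pauli b = ε • (pauli b * pauli a) := by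
  by_cases h : a = 0 ∨ b = 0 ∨ a = b
  · refine ⟨1, Or.inl rfl, ?_⟩
    rcases h with rfl | rfl | rfl <;> simp [pauli]
  · refine ⟨-1, Or.inr rfl, ?_⟩
    ext i j
    fin_cases a <;> fin_cases b <;> simp at h <;> fin_cases i <;> fin_cases j <;>
      simp [pauli, Matrix.mul_apply, Fin.sum_univ_two]

theorem pauliString_mul_comm_or {n : ℕ} (s s' : Fin n → Fin 4) :
    pauliString s * pauliString s' = pauliString s' * pauliString s ∨
      pauliString s * pauliString s' = -(pauliString s' * pauliString s) := by
  choose ε hε h using fun i => pauli_mul_comm_or (s i) (s' i)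
  have hprod : ∏ i, ε i = 1 ∨ ∏ i, ε i = -1 := by
    apply Finset.prod_induction ε (fun z => z = 1 ∨ z = -1) _ (Or.inl rfl) (fun i _ => hε i)
    rintro a b (rfl | rfl) (rfl | rfl) <;> simp
  have key : pauliString s * pauliString s' = (∏ i, ε i) • (pauliString s' * pauliString s) := by
    simp only [pauliString, tensorOp_mul, h, tensorOp_smul]
  rcases hprod with e | e
  · left; rw [key, e, one_smul]
  · right; rw [key, e, neg_smul, one_smul]

theorem IsPauliElement.mul_comm_or {n : ℕ} {M : QubitOp n} (hM : IsPauliElement M)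
    (s : Fin n → Fin 4) :
    M * pauliString s = pauliString s * M ∨ M * pauliString s = -(pauliString s * M) := by
  obtain ⟨k, s', rfl⟩ := hM
  rcases pauliString_mul_comm_or s' s with h | h
  · left; rw [Matrix.smul_mul, h, Matrix.mul_smul]
  · right; rw [Matrix.smul_mul, h, Matrix.mul_smul, smul_neg]

theorem inner_toEuclideanLin_left {n : ℕ} (M : QubitOp n) (u v : Qubits n) :
    inner ℂ (Matrix.toEuclideanLin M u) v = inner ℂ u (Matrix.toEuclideanLin Mᴴ v) := by
  rw [Matrix.toEuclideanLin_conjTranspose_eq_adjoint, LinearMap.adjoint_inner_right]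

theorem inner_toEuclideanLin_of_isometry {n : ℕ} {M : QubitOp n} (hM : Mᴴ * M = 1)
    (u v : Qubits n) :
    inner ℂ (Matrix.toEuclideanLin M u) (Matrix.toEuclideanLin M v) = inner ℂ u v := by
  rw [inner_toEuclideanLin_left, ← toEuclideanLin_mul_apply, hM, toEuclideanLin_one_apply]

/-- A Pauli error that anticommutes with a stabilizer of a codeword has vanishing expectation. -/
theorem inner_eq_zero_of_anticommute {n : ℕ} {M E : QubitOp n} (hM : Mᴴ * M = 1)
    (hME : M * E = -(E * M)) {w : Qubits n} (hw : Matrix.toEuclideanLin M w = w) :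
    inner ℂ w (Matrix.toEuclideanLin E w) = 0 := by
  have h1 : inner ℂ w (Matrix.toEuclideanLin E w) = -inner ℂ w (Matrix.toEuclideanLin E w) := by
    calc inner ℂ w (Matrix.toEuclideanLin E w)
        = inner ℂ (Matrix.toEuclideanLin M w)
            (Matrix.toEuclideanLin M (Matrix.toEuclideanLin E w)) :=
          (inner_toEuclideanLin_of_isometry hM _ _).symm
      _ = -inner ℂ w (Matrix.toEuclideanLin E w) := by
          rw [← toEuclideanLin_mul_apply, hME, map_neg, LinearMap.neg_apply, inner_neg_right,
            toEuclideanLin_mul_apply, hw]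
  exact self_eq_neg.1 h1

/-- A product of two rotated Pauli matrices on two qubits does not preserve the code: otherwise it
would act on it as the scalar `corr`, which would be `± 1`. -/
theorem siteOp_conj_pauli_not_mem {N : ℕ} (hN : 8 ≤ N) {i j : Fin (N + 3)} (hij : i ≠ j)
    (U V : Matrix.unitaryGroup (Fin 2) ℂ) {a b : Fin 4} (ha : a ≠ 0) (hb : b ≠ 0) :
    Matrix.toEuclideanLin
      (siteOp i ((U : Matrix (Fin 2) (Fin 2) ℂ)ᴴ * pauli a * U) *
        siteOp j ((V : Matrix (Fin 2) (Fin 2) ℂ)ᴴ * pauli b * V)) (dickePair N 0) ∉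
      codespace (dickePair N) := by
  intro hmem
  set A := (U : Matrix (Fin 2) (Fin 2) ℂ)ᴴ * pauli a * U with hA
  set B := (V : Matrix (Fin 2) (Fin 2) ℂ)ᴴ * pauli b * V with hB
  have h0 : dickePair N 0 ∈ codespace (dickePair N) := Submodule.subset_span ⟨0, rfl⟩
  have hF : Matrix.toEuclideanLin (siteOp i A * siteOp j B) (dickePair N 0) =
      corr N A B • dickePair N 0 := by
    rw [← sub_eq_zero, ← inner_self_eq_zero (𝕜 := ℂ), inner_sub_right,
      inner_siteOp_mul_siteOp_of_mem hN hij A B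
        (Submodule.sub_mem _ hmem (Submodule.smul_mem _ _ h0)) h0, inner_smul_right, sub_self]
  have hFF : siteOp i A * siteOp j B * (siteOp i A * siteOp j B) = 1 := by
    calc _ = siteOp i A * (siteOp j B * siteOp i A) * siteOp j B := by
          simp only [Matrix.mul_assoc]
      _ = (siteOp i A * siteOp i A) * (siteOp j B * siteOp j B) := by
          rw [← siteOp_commute hij]; simp only [Matrix.mul_assoc]
      _ = 1 := by
          rw [siteOp_mul, siteOp_mul, hA, hB, conj_pauli_mul_self, conj_pauli_mul_self, siteOp_one,
            siteOp_one, Matrix.one_mul]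
  have hsq : (corr N A B ^ 2 - 1) • dickePair N 0 = 0 := by
    have := toEuclideanLin_mul_apply (siteOp i A * siteOp j B) (siteOp i A * siteOp j B)
      (dickePair N 0)
    rw [hFF, toEuclideanLin_one_apply, hF, map_smul, hF, smul_smul] at this
    rw [sub_smul, one_smul, sub_eq_zero, pow_two]
    exact this.symm
  rcases smul_eq_zero.1 hsq with h | h
  · obtain ⟨x, y, e, hn⟩ := exists_bloch_conj_pauli U ha
    obtain ⟨x', y', e', hn'⟩ := exists_bloch_conj_pauli V hb
    rw [hA, hB, e, e', corr_bloch, sub_eq_zero] at h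
    exact corr_bloch_ne_one hN hn hn' (by exact_mod_cast h)
  · exact (orthonormal_dickePair hN).ne_zero 0 h

theorem isNonAdditive_dickePair {N : ℕ} (hN : 8 ≤ N) :
    IsNonAdditive (codespace (dickePair N)) := by
  rintro C' ⟨U, σ, hC'⟩ ⟨S, hP, -, -, hS⟩
  set T : QubitOp (N + 3) := tensorOp fun i => (U i : Matrix (Fin 2) (Fin 2) ℂ) with hT
  have hTT : Tᴴ * T = 1 := tensorOp_conjTranspose_mul_self U
  have hmem : ∀ w, w ∈ C' ↔ ∃ u ∈ codespace (dickePair N), Matrix.toEuclideanLin T u = w := by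
    intro w
    rw [hC', Submodule.mem_map]
    refine exists_congr fun u => and_congr_right fun hu => ?_
    have : (permuteQubits σ).toLinearEquiv.toLinearMap u = u :=
      isPermutationInvariant_dickePair N u hu σ
    rw [LinearMap.comp_apply, this]
  have hij : (0 : Fin (N + 3)) ≠ 1 := by simp
  have h0 : dickePair N 0 ∈ codespace (dickePair N) := Submodule.subset_span ⟨0, rfl⟩
  have hw : Matrix.toEuclideanLin T (dickePair N 0) ∈ C' := (hmem _).2 ⟨_, h0, rfl⟩
  have zero : ∀ a b : Fin 4, a ≠ 0 → b ≠ 0 →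
      corr N ((U 0 : Matrix (Fin 2) (Fin 2) ℂ)ᴴ * pauli a * (U 0 : Matrix (Fin 2) (Fin 2) ℂ))
        ((U 1 : Matrix (Fin 2) (Fin 2) ℂ)ᴴ * pauli b * (U 1 : Matrix (Fin 2) (Fin 2) ℂ)) = 0 := by
    intro a b ha hb
    obtain ⟨s, hs⟩ : ∃ s : Fin (N + 3) → Fin 4,
        siteOp 0 (pauli a) * siteOp 1 (pauli b) = pauliString s := by
      refine ⟨fun k => if k = 0 then a else if k = 1 then b else 0, ?_⟩
      rw [siteOp_pauli_mul_siteOp_pauli hij]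
      · simp
      · intro k hk
        by_contra! h
        simp [h.1, h.2] at hk
    have hconj := siteOp_mul_siteOp_mul_tensorOp U 0 1 (pauli a) (pauli b)
    rw [hs, ← hT] at hconj
    by_cases hcomm : ∀ M ∈ S, (M : QubitOp (N + 3)) * pauliString s = pauliString s * M
    · exfalso
      have hE : Matrix.toEuclideanLin (pauliString s)
          (Matrix.toEuclideanLin T (dickePair N 0)) ∈ C' := by
        rw [hS]
        intro M hM
        rw [← toEuclideanLin_mul_apply, hcomm M hM, toEuclideanLin_mul_apply, (hS _).1 hw M hM]
      obtain ⟨u, hu, hue⟩ := (hmem _).1 hE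
      rw [← toEuclideanLin_mul_apply, hconj, toEuclideanLin_mul_apply] at hue
      have hinj := congrArg (Matrix.toEuclideanLin Tᴴ) hue
      rw [← toEuclideanLin_mul_apply Tᴴ, ← toEuclideanLin_mul_apply Tᴴ, hTT,
        toEuclideanLin_one_apply, toEuclideanLin_one_apply] at hinj
      rw [hinj] at hu
      exact siteOp_conj_pauli_not_mem hN hij (U 0) (U 1) ha hb hu
    · push Not at hcomm
      obtain ⟨M, hM, hne⟩ := hcomm
      have hanti := ((hP M hM).mul_comm_or s).resolve_left hne
      have hz := inner_eq_zero_of_anticommute (Matrix.UnitaryGroup.star_mul_self M) hanti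
        ((hS _).1 hw M hM)
      rw [← toEuclideanLin_mul_apply, hconj, toEuclideanLin_mul_apply,
        inner_toEuclideanLin_of_isometry hTT, inner_siteOp_mul_siteOp hN 0 0 hij, if_pos rfl] at hz
      exact hz
  -- all correlations of traceless operators would vanish, but those of `X ⊗ X` do not
  have hX : (pauli 1).trace = 0 := pauli_trace (by decide)
  obtain ⟨a, b, c, e⟩ := exists_eq_lin_comb_conj_pauli (U 0) hX
  obtain ⟨a', b', c', e'⟩ := exists_eq_lin_comb_conj_pauli (U 1) hX
  have hzero : corr N (pauli 1) (pauli 1) = 0 := by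
    rw [congrArg₂ (corr N) e e']
    simp only [corr_lin_left, corr_lin_right]
    simp [zero]
  have hN2 : (N : ℂ) + 2 ≠ 0 := by exact_mod_cast Nat.succ_ne_zero (N + 1)
  simp [corr, pauli, hN2] at hzero

/-! ### Monomial local gates -/

/-- A tensor product of matrices that are all diagonal (`τ = id`) or all antidiagonal
(`τ = Fin.rev`) permutes the basis vectors up to phases. -/
theorem tensorOp_mulVec_of_monomial {n : ℕ} (τ : Fin 2 → Fin 2)
    (T : Fin n → Matrix (Fin 2) (Fin 2) ℂ) (hT : ∀ i a b, b ≠ τ a → T i a b = 0)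
    (v : (Fin n → Fin 2) → ℂ) (x : Fin n → Fin 2) :
    (tensorOp T *ᵥ v) x = (∏ i, T i (x i) (τ (x i))) * v (τ ∘ x) := by
  rw [Matrix.mulVec, dotProduct, Finset.sum_eq_single (τ ∘ x)]
  · rfl
  · intro y _ hy
    obtain ⟨i, hi⟩ := Function.ne_iff.1 hy
    have : tensorOp T x y = 0 := Finset.prod_eq_zero (Finset.mem_univ i) (hT i _ _ hi)
    rw [this, zero_mul]
  · simp

theorem hammingWeight_le {n : ℕ} (x : Fin n → Fin 2) : hammingWeight x ≤ n :=
  (Finset.card_le_univ _).trans_eq (Fintype.card_fin n)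

theorem prod_bits {n : ℕ} (f : Fin 2 → ℂ) (x : Fin n → Fin 2) :
    ∏ i, f (x i) = f 0 ^ (n - hammingWeight x) * f 1 ^ hammingWeight x := by
  have h : ∀ i, f (x i) = if x i = 1 then f 1 else f 0 := by
    intro i
    generalize x i = c
    fin_cases c <;> simp
  have hc : (Finset.univ.filter fun i => ¬ x i = 1).card = n - hammingWeight x := by
    rw [← Finset.compl_filter, Finset.card_compl, Fintype.card_fin, hammingWeight]
  rw [Finset.prod_congr rfl fun i _ => h i, Finset.prod_ite, Finset.prod_const, Finset.prod_const,
    hc, mul_comm]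
  rfl

theorem hammingWeight_rev {n : ℕ} (x : Fin n → Fin 2) :
    hammingWeight (Fin.rev ∘ x) = n - hammingWeight x := by
  have : hammingWeight (Fin.rev ∘ x) + hammingWeight x = n := by
    rw [hammingWeight_eq_sum, hammingWeight_eq_sum, ← Finset.sum_add_distrib,
      Finset.sum_congr rfl (g := fun _ => 1) fun i _ => ?_]
    · simp
    · simp only [Function.comp_apply]
      generalize x i = c
      fin_cases c <;> simp
  omega

theorem dickeAmp_sub {n w u : ℕ} (hw : w ≤ n) (hu : u ≤ n) :
    dickeAmp n w (n - u) = dickeAmp n (n - w) u := by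
  by_cases h : n - u = w
  · rw [dickeAmp, dickeAmp, if_pos h, if_pos (by omega), Nat.choose_symm hw]
  · rw [dickeAmp, dickeAmp, if_neg h, if_neg (by omega)]

/-- Flipping all qubits exchanges the two logical basis states. -/
theorem codeAmp_sub {N : ℕ} (k : Fin 2) {w : ℕ} (hw : w ≤ N + 3) :
    codeAmp N k (N + 3 - w) = codeAmp N k.rev w := by
  have h3 : N + 3 - N = 3 := by omega
  have h4 : N + 3 - 3 = N := by omega
  have h5 : N + 3 - (N + 3) = 0 := by omega
  fin_cases k <;>
    simp only [codeAmp, Fin.zero_eta, Fin.mk_one, Matrix.cons_val_zero,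
      Matrix.cons_val_one, dickeAmp_sub (Nat.zero_le _) hw,
      dickeAmp_sub (show N ≤ N + 3 by omega) hw, dickeAmp_sub (show 3 ≤ N + 3 by omega) hw,
      dickeAmp_sub le_rfl hw, h3, h4, h5, Nat.sub_zero] <;>
    simp [add_comm]

theorem eq_or_of_codeAmp_ne_zero {N : ℕ} {k : Fin 2} {w : ℕ} (h : codeAmp N k w ≠ 0) :
    (k = 0 ∧ (w = 0 ∨ w = N)) ∨ (k = 1 ∧ (w = 3 ∨ w = N + 3)) := by
  contrapose! h
  fin_cases k <;> simp at h <;> simp [codeAmp, dickeAmp, h]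

/-! ### Logical gates of the generalized quaternion group -/

theorem mul_encoding_eq_iff {n : ℕ} (T : QubitOp n) (v : Fin 2 → Qubits n)
    (g : Matrix (Fin 2) (Fin 2) ℂ) :
    T * encoding v = encoding v * g ↔
      ∀ j x, (T *ᵥ (v j).ofLp) x = v 0 x * g 0 j + v 1 x * g 1 j := by
  rw [← Matrix.ext_iff, forall_comm]
  refine forall_congr' fun j => forall_congr' fun x => ?_
  rw [Matrix.mul_apply (M := encoding v), Fin.sum_univ_two]
  rfl

theorem mem_transversalGroup_iff {n : ℕ} (v : Fin 2 → Qubits n)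
    (g : Matrix.specialUnitaryGroup (Fin 2) ℂ) :
    g ∈ transversalGroup v ↔ ∃ U : Fin n → Matrix.unitaryGroup (Fin 2) ℂ, ∀ j x,
      (tensorOp (fun i => (U i : Matrix (Fin 2) (Fin 2) ℂ)) *ᵥ (v j).ofLp) x =
        v 0 x * (g : Matrix (Fin 2) (Fin 2) ℂ) 0 j +
        v 1 x * (g : Matrix (Fin 2) (Fin 2) ℂ) 1 j :=
  exists_congr fun _ => mul_encoding_eq_iff _ v _

/-- An element of `SU(2)` as an element of `U(2)`. -/
def toUnitary (g : Matrix.specialUnitaryGroup (Fin 2) ℂ) : Matrix.unitaryGroup (Fin 2) ℂ :=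
  ⟨g, (Matrix.mem_specialUnitaryGroup_iff.1 g.2).1⟩

theorem coe_toUnitary (g : Matrix.specialUnitaryGroup (Fin 2) ℂ) :
    (toUnitary g : Matrix (Fin 2) (Fin 2) ℂ) = g := rfl

theorem coe_gateX : (gateX : Matrix (Fin 2) (Fin 2) ℂ) = !![0, -Complex.I; -Complex.I, 0] := rfl

theorem coe_gateZ : (gateZ : Matrix (Fin 2) (Fin 2) ℂ) = !![-Complex.I, 0; 0, Complex.I] := rfl

theorem coe_gatePh (α : ℝ) : (gatePh α : Matrix (Fin 2) (Fin 2) ℂ) =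
    !![Complex.exp (-Complex.I * α / 2), 0; 0, Complex.exp (Complex.I * α / 2)] := rfl

theorem coe_inv (g : Matrix.specialUnitaryGroup (Fin 2) ℂ) :
    ((g⁻¹ : Matrix.specialUnitaryGroup (Fin 2) ℂ) : Matrix (Fin 2) (Fin 2) ℂ) =
      (g : Matrix (Fin 2) (Fin 2) ℂ)ᴴ := rfl

theorem coe_mul (g h : Matrix.specialUnitaryGroup (Fin 2) ℂ) :
    ((g * h : Matrix.specialUnitaryGroup (Fin 2) ℂ) : Matrix (Fin 2) (Fin 2) ℂ) =
      (g : Matrix (Fin 2) (Fin 2) ℂ) * h := rfl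

theorem coe_gateZ_mul_self :
    ((gateZ * gateZ : Matrix.specialUnitaryGroup (Fin 2) ℂ) : Matrix (Fin 2) (Fin 2) ℂ) = -1 := by
  rw [coe_mul, coe_gateZ]
  ext i j
  fin_cases i <;> fin_cases j <;> simp

theorem gatePh_add (α β : ℝ) : gatePh (α + β) = gatePh α * gatePh β := by
  apply Subtype.ext
  rw [coe_mul, coe_gatePh, coe_gatePh, coe_gatePh]
  ext i j
  fin_cases i <;> fin_cases j <;> simp [← Complex.exp_add] <;> ring_nf

theorem gatePh_zero : gatePh 0 = 1 := by
  apply Subtype.ext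
  rw [coe_gatePh]
  ext i j
  fin_cases i <;> fin_cases j <;> simp

theorem gatePh_pow (α : ℝ) (k : ℕ) : gatePh α ^ k = gatePh (k * α) := by
  induction k with
  | zero => rw [pow_zero, Nat.cast_zero, zero_mul, gatePh_zero]
  | succ k ih => rw [pow_succ, ih, ← gatePh_add]; congr 1; push_cast; ring

theorem gatePh_four_pi : gatePh (4 * Real.pi) = 1 := by
  apply Subtype.ext
  have h1 : -Complex.I * ((4 * Real.pi : ℝ) : ℂ) / 2 = -(2 * Real.pi * Complex.I) := by
    push_cast; ring
  have h2 : Complex.I * ((4 * Real.pi : ℝ) : ℂ) / 2 = 2 * Real.pi * Complex.I := by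
    push_cast; ring
  rw [coe_gatePh, h1, h2, Complex.exp_neg, Complex.exp_two_pi_mul_I]
  ext i j
  fin_cases i <;> fin_cases j <;> simp

/-- A diagonal gate applied to every qubit is a logical gate as soon as it acts by one phase on each
logical basis state. -/
theorem mem_transversalGroup_of_diagonal {N : ℕ} (h g : Matrix.specialUnitaryGroup (Fin 2) ℂ)
    {p q : ℂ} (hh : (h : Matrix (Fin 2) (Fin 2) ℂ) = !![p, 0; 0, q])
    (hg01 : (g : Matrix (Fin 2) (Fin 2) ℂ) 0 1 = 0) (hg10 : (g : Matrix (Fin 2) (Fin 2) ℂ) 1 0 = 0)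
    (h0 : p ^ (N + 3) = (g : Matrix (Fin 2) (Fin 2) ℂ) 0 0)
    (hN : p ^ 3 * q ^ N = (g : Matrix (Fin 2) (Fin 2) ℂ) 0 0)
    (h3 : p ^ N * q ^ 3 = (g : Matrix (Fin 2) (Fin 2) ℂ) 1 1)
    (h3N : q ^ (N + 3) = (g : Matrix (Fin 2) (Fin 2) ℂ) 1 1) :
    g ∈ transversalGroup (dickePair N) := by
  rw [mem_transversalGroup_iff]
  refine ⟨fun _ => toUnitary h, fun j x => ?_⟩
  rw [tensorOp_mulVec_of_monomial id _ fun i a b hab => by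
      rw [coe_toUnitary, hh]
      fin_cases a <;> fin_cases b <;> simp at hab ⊢]
  simp only [coe_toUnitary, id, Function.id_comp]
  rw [prod_bits (fun a => (h : Matrix (Fin 2) (Fin 2) ℂ) a a), hh]
  simp only [dickePair_apply]
  by_cases hz : codeAmp N j (hammingWeight x) = 0
  · fin_cases j <;> simp at hz <;> simp [hz, hg01, hg10]
  · rcases eq_or_of_codeAmp_ne_zero hz with ⟨rfl, e | e⟩ | ⟨rfl, e | e⟩ <;>
      simp [e, hg01, hg10, ← h0, ← h3N] <;> simp [h0, h3N, ← hN, ← h3, mul_comm]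

theorem gateZ_mem_transversalGroup {N : ℕ} (h4 : 4 ∣ N) :
    gateZ ∈ transversalGroup (dickePair N) := by
  obtain ⟨m, rfl⟩ := h4
  have e1 : (-Complex.I) ^ (4 * m) = 1 := by
    rw [pow_mul, Even.neg_pow (by decide), Complex.I_pow_four, one_pow]
  have e2 : Complex.I ^ (4 * m) = 1 := by rw [pow_mul, Complex.I_pow_four, one_pow]
  have e3 : (-Complex.I) ^ 3 = Complex.I := by
    rw [Odd.neg_pow (by decide), Complex.I_pow_three, neg_neg]
  rw [← inv_mem_iff]
  refine mem_transversalGroup_of_diagonal gateZ _ coe_gateZ ?_ ?_ ?_ ?_ ?_ ?_ <;>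
    simp [coe_inv, coe_gateZ, pow_add, e1, e2, e3, Complex.I_pow_three]

/-- Applying the phase gate to all qubits implements, up to sign, only the cube of the logical phase
gate. The order of the phase gate divides `2 * N`, which is coprime to `3`, so it is a power of its
cube. -/
theorem gatePh_mem_transversalGroup {N : ℕ} (hN : N ≠ 0) (h4 : 4 ∣ N) (h3 : Nat.Coprime 3 N) :
    gatePh (2 * Real.pi / N) ∈ transversalGroup (dickePair N) := by
  have hNc : (N : ℂ) ≠ 0 := by exact_mod_cast hN
  have hZ := gateZ_mem_transversalGroup h4
  -- applying the phase gate to every qubit yields minus the cube of the logical phase gate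
  have hcube : gateZ * gateZ * gatePh ((3 : ℕ) * (2 * Real.pi / N)) ∈
      transversalGroup (dickePair N) := by
    have eN : Complex.exp (Complex.I * ((2 * Real.pi / N : ℝ) : ℂ) / 2) ^ N = -1 := by
      rw [← Complex.exp_nat_mul, ← Complex.exp_pi_mul_I]
      congr 1
      push_cast
      field_simp
    have eN' : Complex.exp (-Complex.I * ((2 * Real.pi / N : ℝ) : ℂ) / 2) ^ N = -1 := by
      rw [show -Complex.I * ((2 * Real.pi / N : ℝ) : ℂ) / 2 =
        -(Complex.I * ((2 * Real.pi / N : ℝ) : ℂ) / 2) by ring, Complex.exp_neg, inv_pow, eN]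
      norm_num
    have c3 : Complex.exp (Complex.I * (((3 : ℕ) * (2 * Real.pi / N) : ℝ) : ℂ) / 2) =
        Complex.exp (Complex.I * ((2 * Real.pi / N : ℝ) : ℂ) / 2) ^ 3 := by
      rw [← Complex.exp_nat_mul]; congr 1; push_cast; ring
    have c3' : Complex.exp (-Complex.I * (((3 : ℕ) * (2 * Real.pi / N) : ℝ) : ℂ) / 2) =
        Complex.exp (-Complex.I * ((2 * Real.pi / N : ℝ) : ℂ) / 2) ^ 3 := by
      rw [← Complex.exp_nat_mul]; congr 1; push_cast; ring
    have eg : ((gateZ * gateZ * gatePh ((3 : ℕ) * (2 * Real.pi / N)) :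
        Matrix.specialUnitaryGroup (Fin 2) ℂ) : Matrix (Fin 2) (Fin 2) ℂ) =
        !![-Complex.exp (-Complex.I * ((2 * Real.pi / N : ℝ) : ℂ) / 2) ^ 3, 0;
          0, -Complex.exp (Complex.I * ((2 * Real.pi / N : ℝ) : ℂ) / 2) ^ 3] := by
      rw [coe_mul, coe_gateZ_mul_self, coe_gatePh, c3, c3', neg_mul, Matrix.one_mul]
      ext i j
      fin_cases i <;> fin_cases j <;> simp
    refine mem_transversalGroup_of_diagonal (gatePh (2 * Real.pi / N)) _ (coe_gatePh _)
      ?_ ?_ ?_ ?_ ?_ ?_ <;> rw [eg] <;>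
      simp only [pow_add, eN, eN', Matrix.of_apply, Matrix.cons_val_zero, Matrix.cons_val_one,
        Matrix.cons_val', Matrix.cons_val_fin_one] <;> ring
  have hcube' := (Subgroup.mul_mem_cancel_left _ (mul_mem hZ hZ)).1 hcube
  rw [← gatePh_pow] at hcube'
  have hord : gatePh (2 * Real.pi / N) ^ (2 * N) = 1 := by
    rw [gatePh_pow, ← gatePh_four_pi]
    congr 1
    have : (N : ℝ) ≠ 0 := by exact_mod_cast hN
    push_cast
    field_simp
    ring
  obtain ⟨m, hm⟩ := Nat.exists_mul_mod_eq_one_of_coprime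
    (show Nat.Coprime 3 (2 * N) from Nat.Coprime.mul_right (by decide) h3) (by omega)
  have hfin : gatePh (2 * Real.pi / N) = (gatePh (2 * Real.pi / N) ^ 3) ^ m := by
    rw [← pow_mul, ← Nat.div_add_mod (3 * m) (2 * N), hm.2, pow_add, pow_mul, hord, one_pow,
      one_mul, pow_one]
  rw [hfin]
  exact pow_mem hcube' m

/-- As `4 ∣ N`, the phases of the `N + 3` factors `-i X` combine to `(-i) ^ (N + 3) = i`, so that
the logical gate is the inverse of `𝖷`. -/
theorem tensorOp_gateX_dickePair {N : ℕ} (h4 : 4 ∣ N) (j : Fin 2) (x : Fin (N + 3) → Fin 2) :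
    (tensorOp (fun _ => (toUnitary gateX : Matrix (Fin 2) (Fin 2) ℂ)) *ᵥ (dickePair N j).ofLp) x =
      dickePair N 0 x * ((gateX⁻¹ : Matrix.specialUnitaryGroup (Fin 2) ℂ) :
        Matrix (Fin 2) (Fin 2) ℂ) 0 j +
      dickePair N 1 x * ((gateX⁻¹ : Matrix.specialUnitaryGroup (Fin 2) ℂ) :
        Matrix (Fin 2) (Fin 2) ℂ) 1 j := by
  obtain ⟨m, rfl⟩ := h4
  have e1 : (-Complex.I) ^ (4 * m) = 1 := by
    rw [pow_mul, Even.neg_pow (by decide), Complex.I_pow_four, one_pow]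
  have e3 : (-Complex.I) ^ 3 = Complex.I := by
    rw [Odd.neg_pow (by decide), Complex.I_pow_three, neg_neg]
  have hent : ∀ a : Fin 2, (gateX : Matrix (Fin 2) (Fin 2) ℂ) a a.rev = -Complex.I := by
    intro a; fin_cases a <;> simp [coe_gateX]
  rw [tensorOp_mulVec_of_monomial Fin.rev _ fun i a b hab => by
      rw [coe_toUnitary, coe_gateX]
      fin_cases a <;> fin_cases b <;> simp at hab ⊢]
  simp only [coe_toUnitary, hent, Finset.prod_const, Finset.card_univ, Fintype.card_fin, pow_add,
    e1, e3, dickePair_apply, hammingWeight_rev, codeAmp_sub j (hammingWeight_le x), coe_inv,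
    coe_gateX]
  fin_cases j <;> simp [mul_comm]

theorem gateX_mem_transversalGroup {N : ℕ} (h4 : 4 ∣ N) :
    gateX ∈ transversalGroup (dickePair N) := by
  rw [← inv_mem_iff, mem_transversalGroup_iff]
  exact ⟨fun _ => toUnitary gateX, tensorOp_gateX_dickePair h4⟩

/-! ### There are no further logical gates -/

theorem gateZ_mul_self_mem_binaryDihedral (N : ℕ) : gateZ * gateZ ∈ binaryDihedral N :=
  mul_mem (Subgroup.subset_closure (by simp)) (Subgroup.subset_closure (by simp))

/-- The determinant condition `c ^ 2 * t ^ 3 = 1` leaves only a sign for `c` once `t` is fixed, so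
`g` is a power of the phase gate up to the sign `-1 = 𝖹 ^ 2`. -/
theorem mem_binaryDihedral_of_diagonal {N : ℕ} (hN : N ≠ 0)
    {g : Matrix.specialUnitaryGroup (Fin 2) ℂ} {c t : ℂ}
    (hg : (g : Matrix (Fin 2) (Fin 2) ℂ) = !![c, 0; 0, c * t ^ 3]) (ht : t ^ N = 1) :
    g ∈ binaryDihedral N := by
  have hNc : (N : ℂ) ≠ 0 := by exact_mod_cast hN
  have hdet : c ^ 2 * t ^ 3 = 1 := by
    have := (Matrix.mem_specialUnitaryGroup_iff.1 g.2).2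
    rw [hg, Matrix.det_fin_two] at this
    simp only [Matrix.of_apply, Matrix.cons_val_zero, Matrix.cons_val_one, Matrix.cons_val',
      Matrix.cons_val_fin_one] at this
    linear_combination this
  have : NeZero N := ⟨hN⟩
  obtain ⟨k, -, rfl⟩ := (Complex.isPrimitiveRoot_exp N hN).eq_pow_of_pow_eq_one ht
  set ζ := Complex.exp (Real.pi * Complex.I / N) with hζ
  have hζ2 : Complex.exp (2 * Real.pi * Complex.I / N) = ζ ^ 2 := by
    rw [hζ, ← Complex.exp_nat_mul]; congr 1; push_cast; ring
  rw [hζ2] at hg hdet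
  have hζ0 : ζ ^ (3 * k) ≠ 0 := pow_ne_zero _ (Complex.exp_ne_zero _)
  have hpow : ((ζ ^ 2) ^ k) ^ 3 = ζ ^ (3 * k) * ζ ^ (3 * k) := by
    rw [← pow_mul, ← pow_mul, ← pow_add]; congr 1; ring
  have hsq : (c * ζ ^ (3 * k)) * (c * ζ ^ (3 * k)) = 1 := by
    rw [hpow] at hdet
    linear_combination hdet
  have hPh : ((gatePh (2 * Real.pi / N) ^ (3 * k) : Matrix.specialUnitaryGroup (Fin 2) ℂ) :
      Matrix (Fin 2) (Fin 2) ℂ) = !![(ζ ^ (3 * k))⁻¹, 0; 0, ζ ^ (3 * k)] := by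
    have e1 : Complex.I * (((3 * k : ℕ) * (2 * Real.pi / N) : ℝ) : ℂ) / 2 =
        (3 * k : ℕ) * (Real.pi * Complex.I / N) := by
      push_cast
      field_simp
    rw [gatePh_pow, coe_gatePh, hζ, ← Complex.exp_nat_mul, ← Complex.exp_neg, neg_mul, neg_div, e1]
  have hPm : gatePh (2 * Real.pi / N) ^ (3 * k) ∈ binaryDihedral N :=
    pow_mem (Subgroup.subset_closure (by simp)) _
  rw [hpow] at hg
  rcases mul_self_eq_one_iff.1 hsq with e | e
  · have : g = gatePh (2 * Real.pi / N) ^ (3 * k) := by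
      apply Subtype.ext
      rw [hPh, hg, ← mul_assoc, e, one_mul, eq_inv_of_mul_eq_one_left e]
    rw [this]
    exact hPm
  · have : g = gateZ * gateZ * gatePh (2 * Real.pi / N) ^ (3 * k) := by
      apply Subtype.ext
      have e' : c = -(ζ ^ (3 * k))⁻¹ := by
        field_simp
        exact e
      rw [coe_mul, coe_gateZ_mul_self, hPh, hg, ← mul_assoc, e, e', neg_mul, neg_mul,
        Matrix.one_mul]
      ext i j
      fin_cases i <;> fin_cases j <;> simp
    rw [this]
    exact mul_mem (gateZ_mul_self_mem_binaryDihedral N) hPm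

/-- A function on `n` points whose product over all subsets of a fixed size strictly between `0`
and `n` is one, is constant. -/
theorem eq_of_prod_eq_one {n N : ℕ} (h0 : 0 < N) (hn : N < n) (t : Fin n → ℂ)
    (h : ∀ S : Finset (Fin n), S.card = N → ∏ i ∈ S, t i = 1) (i j : Fin n) : t i = t j := by
  by_cases hij : i = j
  · rw [hij]
  obtain ⟨R, hR, hc⟩ := Finset.exists_subset_card_eq
    (s := (Finset.univ.erase i).erase j) (n := N - 1) (by
      rw [Finset.card_erase_of_mem (by simp [Ne.symm hij]),
        Finset.card_erase_of_mem (Finset.mem_univ i), Finset.card_univ, Fintype.card_fin]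
      omega)
  have hiR : i ∉ R := fun hi => by simpa using hR hi
  have hjR : j ∉ R := fun hj => by simpa using hR hj
  have h1 := h (insert i R) (by rw [Finset.card_insert_of_notMem hiR]; omega)
  have h2 := h (insert j R) (by rw [Finset.card_insert_of_notMem hjR]; omega)
  rw [Finset.prod_insert hiR] at h1
  rw [Finset.prod_insert hjR] at h2
  have hne : ∏ k ∈ R, t k ≠ 0 := right_ne_zero_of_mul_eq_one h1
  exact mul_right_cancel₀ hne (h1.trans h2.symm)

/-- Diagonal local gates that preserve the code have the same ratio `t` of diagonal entries on every
qubit, because all strings of weight `N` must acquire the same phase as the zero string. This also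
gives `t ^ N = 1`, and the strings of weight three in `|1̄⟩` acquire the relative phase `t ^ 3`. -/
theorem mem_binaryDihedral_of_diagonal_gates {N : ℕ} (hN : 8 ≤ N)
    {g : Matrix.specialUnitaryGroup (Fin 2) ℂ} (U : Fin (N + 3) → Matrix.unitaryGroup (Fin 2) ℂ)
    (hU : ∀ j x, (tensorOp (fun i => (U i : Matrix (Fin 2) (Fin 2) ℂ)) *ᵥ
      (dickePair N j).ofLp) x = dickePair N 0 x * (g : Matrix (Fin 2) (Fin 2) ℂ) 0 j +
        dickePair N 1 x * (g : Matrix (Fin 2) (Fin 2) ℂ) 1 j)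
    (h01 : ∀ i, (U i : Matrix (Fin 2) (Fin 2) ℂ) 0 1 = 0)
    (h10 : ∀ i, (U i : Matrix (Fin 2) (Fin 2) ℂ) 1 0 = 0) : g ∈ binaryDihedral N := by
  set α : Fin (N + 3) → ℂ := fun i => (U i : Matrix (Fin 2) (Fin 2) ℂ) 0 0 with hα
  set t : Fin (N + 3) → ℂ := fun i => (U i : Matrix (Fin 2) (Fin 2) ℂ) 1 1 / α i with ht
  have hα0 : ∀ i, α i ≠ 0 := by
    intro i hi
    have := congrFun (congrFun (Matrix.UnitaryGroup.star_mul_self (U i)) 0) 0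
    rw [Matrix.mul_apply, Fin.sum_univ_two, h10 i, show (U i : Matrix (Fin 2) (Fin 2) ℂ) 0 0 = 0
      from hi] at this
    simp at this
  set D := ∏ i, α i with hD
  have hD0 : D ≠ 0 := Finset.prod_ne_zero_iff.2 fun i _ => hα0 i
  -- the phase acquired by a basis vector, relative to that of the zero string
  have hact : ∀ (S : Finset (Fin (N + 3))) (j : Fin 2),
      D * (∏ i ∈ S, t i) * codeAmp N j S.card =
        codeAmp N 0 S.card * (g : Matrix (Fin 2) (Fin 2) ℂ) 0 j +
        codeAmp N 1 S.card * (g : Matrix (Fin 2) (Fin 2) ℂ) 1 j := by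
    intro S j
    have h := hU j (bitString S)
    rw [tensorOp_mulVec_of_monomial id _ fun i a b hab => by
      fin_cases a <;> fin_cases b <;> simp at hab <;> simp [h01, h10]] at h
    simp only [id, Function.id_comp, dickePair_apply, hammingWeight_bitString] at h
    rw [← h]
    congr 1
    have hS : ∏ i ∈ S, t i = ∏ i, if i ∈ S then t i else 1 := by simp
    rw [hD, hS, ← Finset.prod_mul_distrib]
    refine Finset.prod_congr rfl fun i _ => ?_
    by_cases hi : i ∈ S
    · simp only [bitString, hi, if_true, ht]
      exact mul_div_cancel₀ _ (hα0 i)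
    · simp [bitString, hi, hα]
  have cross : ∀ w, (codeAmp N 0 w : ℂ) * codeAmp N 1 w = 0 := by
    intro w
    exact_mod_cast codeAmp_mul_eq_zero hN (k := 0) (l := 1) (w := w) (u := w) (by omega) (by omega)
      (Or.inl (by decide))
  have p0 : (codeAmp N 0 0 : ℂ) ≠ 0 := by exact_mod_cast (codeAmp_zero_zero_pos hN).ne'
  have pN : (codeAmp N 0 N : ℂ) ≠ 0 := by exact_mod_cast (codeAmp_zero_self_pos hN).ne'
  have p3 : (codeAmp N 1 3 : ℂ) ≠ 0 := by exact_mod_cast (codeAmp_one_three_pos hN).ne'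
  have q0 := (mul_eq_zero.1 (cross 0)).resolve_left p0
  have qN := (mul_eq_zero.1 (cross N)).resolve_left pN
  have q3 := (mul_eq_zero.1 (cross 3)).resolve_right p3
  have exS : ∀ w ≤ N + 3, ∃ S : Finset (Fin (N + 3)), S.card = w := fun w hw => by
    obtain ⟨S, -, hS⟩ := Finset.exists_subset_card_eq
      (s := (Finset.univ : Finset (Fin (N + 3)))) (n := w) (by simpa using hw)
    exact ⟨S, hS⟩
  have g00 : (g : Matrix (Fin 2) (Fin 2) ℂ) 0 0 = D := by
    have h := hact ∅ 0
    rw [Finset.card_empty, Finset.prod_empty, q0] at h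
    apply mul_left_cancel₀ p0
    linear_combination -h
  have g01 : (g : Matrix (Fin 2) (Fin 2) ℂ) 0 1 = 0 := by
    have h := hact ∅ 1
    rw [Finset.card_empty, Finset.prod_empty, q0] at h
    apply mul_left_cancel₀ p0
    linear_combination -h
  have hprod : ∀ S : Finset (Fin (N + 3)), S.card = N → ∏ i ∈ S, t i = 1 := by
    intro S hS
    have h := hact S 0
    rw [hS, qN, g00] at h
    apply mul_left_cancel₀ (mul_ne_zero hD0 pN)
    linear_combination h
  have hconst : ∀ i, t i = t 0 :=
    fun i => eq_of_prod_eq_one (by omega) (by omega) t hprod i 0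
  have htN : t 0 ^ N = 1 := by
    obtain ⟨S, hS⟩ := exS N (by omega)
    have h := hprod S hS
    rwa [Finset.prod_congr rfl fun i _ => hconst i, Finset.prod_const, hS] at h
  obtain ⟨S, hS⟩ := exS 3 (by omega)
  have g10 : (g : Matrix (Fin 2) (Fin 2) ℂ) 1 0 = 0 := by
    have h := hact S 0
    rw [hS, q3] at h
    apply mul_left_cancel₀ p3
    linear_combination -h
  have g11 : (g : Matrix (Fin 2) (Fin 2) ℂ) 1 1 = D * t 0 ^ 3 := by
    have h := hact S 1
    rw [Finset.prod_congr rfl fun i _ => hconst i, Finset.prod_const, hS, q3] at h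
    apply mul_left_cancel₀ p3
    linear_combination -h
  refine mem_binaryDihedral_of_diagonal (by omega) (c := D) (t := t 0) ?_ htN
  ext i j
  fin_cases i <;> fin_cases j <;> simp [g00, g01, g10, g11]

/-- A local gate that preserves the code preserves its two-site correlations. Since `Z ⊗ Z` is the
unique most correlated pair of traceless Hermitian involutions, each tensor factor maps `Z` to `± Z`
under conjugation, with a common sign: all factors are diagonal or all are antidiagonal. -/
theorem diagonal_or_antidiagonal {N : ℕ} (hN : 8 ≤ N)
    (U : Fin (N + 3) → Matrix.unitaryGroup (Fin 2) ℂ)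
    (hU : Matrix.toEuclideanLin (tensorOp fun i => (U i : Matrix (Fin 2) (Fin 2) ℂ))
      (dickePair N 0) ∈ codespace (dickePair N)) :
    (∀ i, (U i : Matrix (Fin 2) (Fin 2) ℂ) 0 1 = 0 ∧ (U i : Matrix (Fin 2) (Fin 2) ℂ) 1 0 = 0) ∨
    (∀ i, (U i : Matrix (Fin 2) (Fin 2) ℂ) 0 0 = 0 ∧ (U i : Matrix (Fin 2) (Fin 2) ℂ) 1 1 = 0) := by
  have hTT := tensorOp_conjTranspose_mul_self U
  choose x y hxy hn using fun i => exists_bloch_conj_pauli (U i) (a := 3) (by decide)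
  have hZ : pauli 3 = !![((1 : ℝ) : ℂ), 0; star 0, -((1 : ℝ) : ℂ)] := by simp [pauli]
  have hc : ∀ i j, i ≠ j → y i = 0 ∧ y j = 0 ∧ x i * x j = 1 := by
    intro i j hij
    have h1 := inner_siteOp_mul_siteOp_of_mem hN hij (pauli 3) (pauli 3) hU hU
    rw [inner_toEuclideanLin_of_isometry hTT, ← toEuclideanLin_mul_apply,
      siteOp_mul_siteOp_mul_tensorOp, toEuclideanLin_mul_apply,
      inner_toEuclideanLin_of_isometry hTT, inner_siteOp_mul_siteOp hN 0 0 hij, if_pos rfl,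
      orthonormal_iff_ite.1 (orthonormal_dickePair hN), if_pos rfl, mul_one, hxy, hxy, hZ,
      corr_bloch, corr_bloch] at h1
    have h2 := Complex.ofReal_injective h1
    simp only [Complex.zero_re, Complex.zero_im, mul_zero, add_zero, mul_one] at h2
    exact eq_zero_of_corr_bloch_eq hN (hn i) (hn j) h2
  have hy : ∀ i, y i = 0 := by
    intro i
    by_cases hi : i = 0
    · exact (hc i 1 (by rw [hi]; simp)).1
    · exact (hc i 0 hi).1
  have hx0 : x 0 = 1 ∨ x 0 = -1 := by
    have := hn 0
    rw [hy 0] at this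
    simpa using this
  have hx : ∀ i, x i = x 0 := by
    intro i
    by_cases hi : i = 0
    · rw [hi]
    · have := (hc i 0 hi).2.2
      rcases hx0 with h | h <;> rw [h] at this ⊢ <;> linarith
  have hent : ∀ i, pauli 3 * (U i : Matrix (Fin 2) (Fin 2) ℂ) =
      (U i : Matrix (Fin 2) (Fin 2) ℂ) * !![(x 0 : ℂ), 0; 0, -(x 0 : ℂ)] := by
    intro i
    have h1 : (U i : Matrix (Fin 2) (Fin 2) ℂ) * (U i : Matrix (Fin 2) (Fin 2) ℂ)ᴴ = 1 :=
      Matrix.mem_unitaryGroup_iff.1 (U i).2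
    have h2 := congrArg (fun M => (U i : Matrix (Fin 2) (Fin 2) ℂ) * M) (hxy i)
    simp only [hy, hx, star_zero] at h2
    rw [← h2, ← Matrix.mul_assoc, ← Matrix.mul_assoc, h1, Matrix.one_mul]
  rcases hx0 with h | h
  · left
    intro i
    have e := hent i
    rw [h] at e
    have e01 := congrFun (congrFun e 0) 1
    have e10 := congrFun (congrFun e 1) 0
    simp [pauli, Matrix.mul_apply, Fin.sum_univ_two] at e01 e10
    exact ⟨self_eq_neg.1 e01, neg_eq_self.1 e10⟩
  · right
    intro i
    have e := hent i
    rw [h] at e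
    have e00 := congrFun (congrFun e 0) 0
    have e11 := congrFun (congrFun e 1) 1
    simp [pauli, Matrix.mul_apply, Fin.sum_univ_two] at e00 e11
    exact ⟨self_eq_neg.1 e00, neg_eq_self.1 e11⟩

theorem transversalGroup_dickePair {N : ℕ} (hN : 8 ≤ N) (h4 : 4 ∣ N) (h3 : Nat.Coprime 3 N) :
    transversalGroup (dickePair N) = binaryDihedral N := by
  apply le_antisymm
  · intro g hg
    obtain ⟨U, hU⟩ := (mem_transversalGroup_iff _ g).1 hg
    have hmem : Matrix.toEuclideanLin (tensorOp fun i => (U i : Matrix (Fin 2) (Fin 2) ℂ))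
        (dickePair N 0) ∈ codespace (dickePair N) := by
      have e : Matrix.toEuclideanLin (tensorOp fun i => (U i : Matrix (Fin 2) (Fin 2) ℂ))
          (dickePair N 0) = (g : Matrix (Fin 2) (Fin 2) ℂ) 0 0 • dickePair N 0 +
            (g : Matrix (Fin 2) (Fin 2) ℂ) 1 0 • dickePair N 1 := by
        ext x
        rw [ofLp_toEuclideanLin, hU]
        simp [mul_comm]
      rw [e]
      exact add_mem (Submodule.smul_mem _ _ (Submodule.subset_span ⟨0, rfl⟩))
        (Submodule.smul_mem _ _ (Submodule.subset_span ⟨1, rfl⟩))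
    rcases diagonal_or_antidiagonal hN U hmem with hd | hd
    · exact mem_binaryDihedral_of_diagonal_gates hN U hU (fun i => (hd i).1) fun i => (hd i).2
    · -- after composing with the gate `𝖷⁻¹`, which is implemented by `𝖷` on every qubit, all tensor
      -- factors are diagonal
      have hgX : g * gateX⁻¹ ∈ binaryDihedral N := by
        refine mem_binaryDihedral_of_diagonal_gates hN (fun i => U i * toUnitary gateX) ?_ ?_ ?_
        · have e : tensorOp (fun i => ((U i * toUnitary gateX : Matrix.unitaryGroup (Fin 2) ℂ) :
              Matrix (Fin 2) (Fin 2) ℂ)) =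
              tensorOp (fun i => (U i : Matrix (Fin 2) (Fin 2) ℂ)) *
              tensorOp (fun _ => (toUnitary gateX : Matrix (Fin 2) (Fin 2) ℂ)) := by
            rw [tensorOp_mul]; rfl
          rw [← mul_encoding_eq_iff] at hU ⊢
          rw [e, Matrix.mul_assoc, (mul_encoding_eq_iff _ _ _).2 (tensorOp_gateX_dickePair h4),
            ← Matrix.mul_assoc, hU, Matrix.mul_assoc, coe_mul]
        all_goals
          intro i
          rw [Matrix.UnitaryGroup.mul_val, coe_toUnitary, coe_gateX, Matrix.mul_apply,
            Fin.sum_univ_two]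
          simp [(hd i).1, (hd i).2]
      have hX : gateX ∈ binaryDihedral N := Subgroup.subset_closure (by simp)
      exact (Subgroup.mul_mem_cancel_right _ (inv_mem hX)).1 hgX
  · rw [binaryDihedral, Subgroup.closure_le]
    rintro g (rfl | rfl | rfl)
    · exact gateX_mem_transversalGroup h4
    · exact gateZ_mem_transversalGroup h4
    · exact gatePh_mem_transversalGroup (by omega) h4 h3

theorem dickePair_code_properties {N : ℕ} (hN : 8 ≤ N) :
    Orthonormal ℂ (dickePair N) ∧ IsCode (codespace (dickePair N)) 2 3 ∧
      IsPermutationInvariant (codespace (dickePair N)) ∧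
      IsNonAdditive (codespace (dickePair N)) :=
  ⟨orthonormal_dickePair hN, isCode_dickePair hN, isPermutationInvariant_dickePair N,
    isNonAdditive_dickePair hN⟩

end DickeCode

end

theorem mainTheorem2 :
    (∀ r : ℕ, 3 ≤ r →
      Orthonormal ℂ (DickeCode.codeword r) ∧
      DickeCode.IsCode (DickeCode.codespace (DickeCode.codeword r)) 2 3 ∧
      DickeCode.IsPermutationInvariant (DickeCode.codespace (DickeCode.codeword r)) ∧
      DickeCode.IsNonAdditive (DickeCode.codespace (DickeCode.codeword r)) ∧
      DickeCode.transversalGroup (DickeCode.codeword r) = DickeCode.generalizedQuaternion r) ∧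
    (Orthonormal ℂ DickeCode.codeword11 ∧
      DickeCode.IsCode (DickeCode.codespace DickeCode.codeword11) 2 3 ∧
      DickeCode.IsPermutationInvariant (DickeCode.codespace DickeCode.codeword11) ∧
      DickeCode.IsNonAdditive (DickeCode.codespace DickeCode.codeword11) ∧
      DickeCode.gateT ∈ DickeCode.transversalGroup DickeCode.codeword11) := by
  constructor
  · intro r hr
    have h8 : 8 ≤ 2 ^ r := by
      calc 8 = 2 ^ 3 := by norm_num
        _ ≤ 2 ^ r := Nat.pow_le_pow_right (by norm_num) hr
    rw [DickeCode.codeword_eq_dickePair r (by omega)]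
    obtain ⟨h1, h2, h3, h4⟩ := DickeCode.dickePair_code_properties h8
    exact ⟨h1, h2, h3, h4, DickeCode.transversalGroup_dickePair h8
      (pow_dvd_pow 2 (by omega : 2 ≤ r)) (Nat.Coprime.pow_right r (by decide))⟩
  · rw [DickeCode.codeword11_eq_dickePair]
    obtain ⟨h1, h2, h3, h4⟩ := DickeCode.dickePair_code_properties (le_refl 8)
    refine ⟨h1, h2, h3, h4, ?_⟩
    have hT : DickeCode.gateT = DickeCode.gatePh (2 * Real.pi / (8 : ℕ)) := by
      rw [DickeCode.gateT]
      congr 1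
      push_cast
      ring
    rw [hT]
    exact DickeCode.gatePh_mem_transversalGroup (by norm_num) (by norm_num) (by decide)
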